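/- **Setting.** There are $N$ agents. Agent $i$ has a compact convex set $X_i\subset\mathbb R^{n_i}$, a constraint function $g_i$ with values in $(\mathbb R\cup\{\pm\infty\})^m$ whose components are proper convex functions on $\mathbb R^{n_i}$, and cost functions $f_{i,t}:\mathbb R^{n_i}\to\mathbb R\cup\{\pm\infty\}$, $t\ge 0$, which are proper and convex. All $f_{i,t}$ and all components of $g_i$ are finite on a neighbourhood of $X_i$, and the subgradients of the costs are uniformly bounded: there is $C_f$ with $\|s\|\le C_f$ for all $i$, $t\ge0$, $x\in X_i$, $s\in\partial f_{i,t}(x)$. The set $\mathcal X=\{x=(x_1,\dots,x_N)\in\prod_i X_i:\ \sum_i g_i(x_i)\le 0\}$ (componentwise) is nonempty. At each time $t\ge 0$ the agents communicate over a directed graph on $\{1,\dots,N\}$ with edge set $\mathcal E_t$ containing all self-loops; no balance of in- and out-degrees is required. The weight matrix $A_t=(a_{ij,t})$ has $a_{ij,t}>0$ if $(j,i)\in\mathcal E_t$ and $a_{ij,t}=0$ otherwise, and there are constants $0<a<1$ and $Q\in\{1,2,\dots\}$ such that: every nonzero $a_{ij,t}$ is at least $a$; $\sum_i a_{ij,t}=1$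 for all $j$ and $\sum_j a_{ij,t}\le 1$ for all $i$; and for every $t\ge1$ the graph with edge set $\mathcal E_t\cup\dots\cup\mathcal E_{t+Q-1}$ is strongly connected. **Algorithm (distributed online primal-dual push-sum).** Let $0<\kappa<1/4$, $\alpha_0=\beta_0=1$, and $\alpha_t=1/\sqrt t$, $\beta_t=1/t^{\kappa}$ for $t\ge1$. Start from $w_{i,0}=1$, any $x_{i,0}\in X_i$, $\mu_{i,0}=0$, $y_{i,0}=g_i(x_{i,0})$. For $t\ge 0$ put $w_{i,t+1}=\sum_j a_{ij,t}w_{j,t}$, $\hat\mu_{i,t}=\sum_j a_{ij,t}\mu_{j,t}$, $\hat y_{i,t}=\sum_j a_{ij,t}y_{j,t}$, choose any $$s_{i,t+1}\in\partial f_{i,t}(x_{i,t})+\partial g_i(x_{i,t})\,\frac{\hat\mu_{i,t}}{w_{i,t+1}}$$ (where $\partial g_i(x)$ is the set of matrices whose $k$-th column is a subgradient at $x$ of the $k$-th component of $g_i$), and set, with $P_{X_i}$ the Euclidean projection and $[\cdot]_+$ the componentwise positive part, $$x_{i,t+1}=P_{X_i}(x_{i,t}-\alpha_t s_{i,t+1}),\qquad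 \mu_{i,t+1}=\Big[\hat\mu_{i,t}+\alpha_t\Big(\frac{\hat y_{i,t}}{w_{i,t+1}^2}-\beta_t\frac{\hat\mu_{i,t}}{w_{i,t+1}}\Big)\Big]_+,\qquad y_{i,t+1}=\hat y_{i,t}+g_i(x_{i,t+1})-g_i(x_{i,t}).$$ **Theorem.** For every $T\ge1$ the minimum of $\sum_{t=1}^T\sum_i f_{i,t}(x_i)$ over $x\in\mathcal X$ is attained. There is a constant $C>0$, depending only on $N,m$, the sets $X_i$, the functions $g_i$, and $a,Q,C_f,\kappa$, such that for all costs, graphs and weights as above, every run of the algorithm, every $T\ge1$ and every minimizer $x^*$ of $\sum_{t=1}^T\sum_i f_{i,t}(x_i)$ over $\mathcal X$, $$\mathrm{Reg}(T):=\sum_{t=1}^T\sum_{i=1}^N f_{i,t}(x_{i,t})-\sum_{t=1}^T\sum_{i=1}^N f_{i,t}(x_i^*)\le C\,T^{\frac12+2\kappa},\qquad \mathrm{Reg}^c(T):=\Big\|\Big[\sum_{t=1}^T\sum_{i=1}^N g_i(x_{i,t})\Big]_+\Big\|\le C\,T^{1-\frac{\kappa}{2}}.$$ No boundedness of the multipliers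 $\mu_{i,t}$ is assumed. -/

import Mathlib

open Finset

noncomputable section

namespace OnlinePushSum

/-- Euclidean space of dimension `d`. -/
abbrev Eu (d : ℕ) : Type := EuclideanSpace ℝ (Fin d)

/-! ### Convex analysis for extended-real-valued functions -/

/-- The effective domain of an extended-real-valued function. -/
def effDom {d : ℕ} (h : Eu d → EReal) : Set (Eu d) := {z | h z < ⊤}

/-- A proper convex function: finite somewhere, never `-∞`, with convex epigraph. -/
structure IsProperConvex {d : ℕ} (h : Eu d → EReal) : Prop where
  lt_top : ∃ z, h z < ⊤
  bot_lt : ∀ z, ⊥ < h z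
  convex_epigraph : Convex ℝ {p : Eu d × ℝ | h p.1 ≤ (p.2 : EReal)}

/-- The subdifferential: all `s` with `h z ≥ h x + ⟨s, z - x⟩` for every `z` in the whole space. -/
def subdiff {d : ℕ} (h : Eu d → EReal) (x : Eu d) : Set (Eu d) :=
  {s | ∀ z, h x + ((inner ℝ s (z - x) : ℝ) : EReal) ≤ h z}

/-- `p` is the Euclidean projection of `z` onto `S`. -/
def IsProjection {d : ℕ} (S : Set (Eu d)) (z p : Eu d) : Prop :=
  p ∈ S ∧ ∀ q ∈ S, ‖z - p‖ ≤ ‖z - q‖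

/-- Componentwise projection onto the nonnegative orthant. -/
def orthantProj {m : ℕ} (z : Eu m) : Eu m := WithLp.toLp 2 fun k => max (z k) 0

/-- The vector of real values of an `m`-tuple of extended-real-valued functions
(used only at points where all of them are finite). -/
def realVec {d m : ℕ} (h : Eu d → Fin m → EReal) (x : Eu d) : Eu m :=
  WithLp.toLp 2 fun k => (h x k).toReal

/-- The set `∂φ(x) + ∂h(x) ν`, where `∂h(x)` consists of the matrices whose `k`-th column is a
subgradient at `x` of the `k`-th component of `h`. -/
def lagrangianSubdiff {d m : ℕ} (φ : Eu d → EReal) (h : Eu d → Fin m → EReal)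
    (x : Eu d) (ν : Eu m) : Set (Eu d) :=
  {s | ∃ p ∈ subdiff φ x, ∃ q : Fin m → Eu d,
    (∀ k, q k ∈ subdiff (fun z => h z k) x) ∧ s = p + ∑ k, ν k • q k}

/-! ### Communication graphs -/

/-- Strong connectivity: a directed path from every node to every node. -/
def StronglyConnected {V : Type*} (G : Digraph V) : Prop :=
  ∀ u v, Relation.ReflTransGen G.Adj u v

/-- The graph whose edge set is the union of the edge sets at times `t, …, t + Q - 1`. -/
def windowGraph {V : Type*} (G : ℕ → Digraph V) (t Q : ℕ) : Digraph V where
  Adj u v := ∃ l < Q, (G (t + l)).Adj u v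

/-- Time-varying directed graphs with self-loops and their weighted adjacency matrices
(`A t i j` is the weight of the edge from `j` to `i`): positive weights at least `a`,
columns summing to one, rows summing to at most one, and joint strong connectivity over
windows of length `Q`. The digraphs need not be balanced. -/
structure GraphAssumption {N : ℕ} (a : ℝ) (Q : ℕ) (G : ℕ → Digraph (Fin N))
    (A : ℕ → Matrix (Fin N) (Fin N) ℝ) : Prop where
  self_loop : ∀ t i, (G t).Adj i i
  weight_pos : ∀ t i j, (G t).Adj j i → 0 < A t i j
  weight_zero : ∀ t i j, ¬ (G t).Adj j i → A t i j = 0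
  weight_ge : ∀ t i j, 0 < A t i j → a ≤ A t i j
  col_sum : ∀ t j, ∑ i, A t i j = 1
  row_sum : ∀ t i, ∑ j, A t i j ≤ 1
  connected : ∀ t, 1 ≤ t → StronglyConnected (windowGraph G t Q)

/-! ### The online problem -/

/-- The feasible set: `x i ∈ X i` for all `i` and `∑ i, g i (x i) ≤ 0` componentwise. -/
def feasibleSet {N m : ℕ} {n : Fin N → ℕ} (X : ∀ i, Set (Eu (n i)))
    (g : ∀ i, Eu (n i) → Fin m → EReal) : Set (∀ i, Eu (n i)) :=
  {x | (∀ i, x i ∈ X i) ∧ ∀ k, (∑ i, realVec (g i) (x i)) k ≤ 0}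

/-- The local cost functions `f t i`: proper and convex, finite on a neighbourhood of `X i`, with
subgradients at the points of `X i` bounded by `Cf`, uniformly in time. -/
structure CostAssumption {N : ℕ} {n : Fin N → ℕ} (X : ∀ i, Set (Eu (n i))) (Cf : ℝ)
    (f : ℕ → ∀ i, Eu (n i) → EReal) : Prop where
  convex : ∀ t i, IsProperConvex (f t i)
  finite_near : ∀ t i, X i ⊆ interior (effDom (f t i))
  subgrad_le : ∀ t i, ∀ x ∈ X i, ∀ s ∈ subdiff (f t i) x, ‖s‖ ≤ Cf

/-- The cumulative cost over `t = 1, …, T` of a sequence of decisions. -/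
def totalCost {N : ℕ} {n : Fin N → ℕ} (f : ℕ → ∀ i, Eu (n i) → EReal)
    (x : ℕ → ∀ i, Eu (n i)) (T : ℕ) : ℝ :=
  ∑ t ∈ Icc 1 T, ∑ i, (f t i (x t i)).toReal

/-- `z` is a best fixed feasible decision in hindsight for the horizon `T`. -/
def IsBestFixed {N m : ℕ} {n : Fin N → ℕ} (X : ∀ i, Set (Eu (n i)))
    (g : ∀ i, Eu (n i) → Fin m → EReal) (f : ℕ → ∀ i, Eu (n i) → EReal) (T : ℕ)
    (z : ∀ i, Eu (n i)) : Prop :=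
  z ∈ feasibleSet X g ∧
    ∀ z' ∈ feasibleSet X g, totalCost f (fun _ => z) T ≤ totalCost f (fun _ => z') T

/-- The regret of the decisions `x` against the fixed decision `z`. -/
def regret {N : ℕ} {n : Fin N → ℕ} (f : ℕ → ∀ i, Eu (n i) → EReal)
    (x : ℕ → ∀ i, Eu (n i)) (z : ∀ i, Eu (n i)) (T : ℕ) : ℝ :=
  totalCost f x T - totalCost f (fun _ => z) T

/-- The violation of the coupled constraint, `‖[∑ₜ ∑ᵢ gᵢ(x_{i,t})]₊‖`. -/
def violation {N m : ℕ} {n : Fin N → ℕ} (g : ∀ i, Eu (n i) → Fin m → EReal)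
    (x : ℕ → ∀ i, Eu (n i)) (T : ℕ) : ℝ :=
  ‖orthantProj (∑ t ∈ Icc 1 T, ∑ i, realVec (g i) (x t i))‖

/-! ### The distributed online primal-dual push-sum algorithm -/

/-- The primal-dual stepsizes `α₀ = 1`, `αₜ = 1/√t`. -/
def alpha (t : ℕ) : ℝ := if t = 0 then 1 else 1 / Real.sqrt t

/-- The penalty stepsizes `β₀ = 1`, `βₜ = 1/t^κ`. -/
def beta (κ : ℝ) (t : ℕ) : ℝ := if t = 0 then 1 else 1 / (t : ℝ) ^ κ

/-- The sequences produced by the algorithm: push-sum weights `w t i`, decisions `x t i`,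
subgradients `s t i` (meaningful for `t ≥ 1`), multipliers `μ t i`, trackers `y t i`. -/
structure Iterates (N m : ℕ) (n : Fin N → ℕ) where
  w : ℕ → Fin N → ℝ
  x : ℕ → ∀ i, Eu (n i)
  s : ℕ → ∀ i, Eu (n i)
  μ : ℕ → Fin N → Eu m
  y : ℕ → Fin N → Eu m

/-- One round of weighted averaging: `∑ j, A t i j • z t j`. -/
def mix {N m : ℕ} (A : ℕ → Matrix (Fin N) (Fin N) ℝ) (z : ℕ → Fin N → Eu m)
    (t : ℕ) (i : Fin N) : Eu m :=
  ∑ j, A t i j • z t j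

/-- `S` is a run of the distributed online primal-dual push-sum algorithm, with any choice of
initial decisions `x 0 i ∈ X i` and of subgradients. -/
structure IsRun {N m : ℕ} {n : Fin N → ℕ} (X : ∀ i, Set (Eu (n i)))
    (g : ∀ i, Eu (n i) → Fin m → EReal) (f : ℕ → ∀ i, Eu (n i) → EReal)
    (A : ℕ → Matrix (Fin N) (Fin N) ℝ) (κ : ℝ) (S : Iterates N m n) : Prop where
  w_zero : ∀ i, S.w 0 i = 1
  x_zero : ∀ i, S.x 0 i ∈ X i
  μ_zero : ∀ i, S.μ 0 i = 0
  y_zero : ∀ i, S.y 0 i = realVec (g i) (S.x 0 i)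
  w_succ : ∀ t i, S.w (t + 1) i = ∑ j, A t i j * S.w t j
  s_succ : ∀ t i, S.s (t + 1) i ∈
    lagrangianSubdiff (f t i) (g i) (S.x t i) ((S.w (t + 1) i)⁻¹ • mix A S.μ t i)
  x_succ : ∀ t i,
    IsProjection (X i) (S.x t i - alpha t • S.s (t + 1) i) (S.x (t + 1) i)
  μ_succ : ∀ t i, S.μ (t + 1) i =
    orthantProj (mix A S.μ t i + alpha t •
      (((S.w (t + 1) i) ^ 2)⁻¹ • mix A S.y t i
        - beta κ t • ((S.w (t + 1) i)⁻¹ • mix A S.μ t i)))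
  y_succ : ∀ t i, S.y (t + 1) i =
    mix A S.y t i + (realVec (g i) (S.x (t + 1) i) - realVec (g i) (S.x t i))

end OnlinePushSum

end

open OnlinePushSum

/-! Total mass forces rows that sum to at most one to sum to exactly one, so the matrices are doubly
stochastic and the push-sum weights stay equal to 1 (`IsRun.w_eq_one`). What remains is ordinary
averaging with perturbations. Over `N * Q` steps every transition weight is at least `a ^ (N * Q)`,
so the disagreement contracts geometrically (`dispersion_window_le`).

This bounds the trackers by some `Y`, since their perturbations are bounded and their average is
that of the constraint values. The penalty `β` then acts as a leak: multipliers stay below `Y / β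
t`, so dual steps are at most `2 * Y * α t`, and the summed disagreement of the multipliers is of
order `√T` (`exists_sum_dispersion_μ_le`). No a priori multiplier bound is needed.

The squared distance to `(z, ν)`, with `z` feasible and `ν ≥ 0`, gives the basic inequality
(`IsRun.energy_step_le`). The trackers need not be accurate: only their sum and their boundedness
enter. The error of pairing them with the local multipliers is a nonpositive term plus a multiple of
the multiplier disagreement. Division by `α t` and summation by parts yield
`IsRun.regret_add_inner_le`: regret plus `⟨ν, ∑ g⟩` is `O(T^(1/2 + 2κ)) + O(‖ν‖² T^(1 - κ))`.

Taking `ν = 0` bounds the regret. For the violation, the regret is at least of order `-T`;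
optimizing over `ν` bounds the squared violation by a multiple of `T * T^(1 - κ)`. -/

namespace OnlinePushSum

/-! ### Subgradients of proper convex functions -/

section ConvexAnalysis

variable {d : ℕ} {h : Eu d → EReal}

theorem IsProperConvex.coe_toReal (hh : IsProperConvex h) {x : Eu d} (hx : x ∈ effDom h) :
    ((h x).toReal : EReal) = h x :=
  EReal.coe_toReal (ne_of_lt hx) (hh.bot_lt x).ne'

theorem IsProperConvex.convexOn_toReal (hh : IsProperConvex h) :
    ConvexOn ℝ (effDom h) fun z => (h z).toReal := by
  have key : ∀ ⦃x⦄, x ∈ effDom h → ∀ ⦃y⦄, y ∈ effDom h → ∀ ⦃a b : ℝ⦄, 0 ≤ a → 0 ≤ b → a + b = 1 →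
      h (a • x + b • y) ≤ ((a * (h x).toReal + b * (h y).toReal : ℝ) : EReal) := by
    intro x hx y hy a b ha hb hab
    have hx' : (x, (h x).toReal) ∈ {p : Eu d × ℝ | h p.1 ≤ (p.2 : EReal)} :=
      (hh.coe_toReal hx).ge
    have hy' : (y, (h y).toReal) ∈ {p : Eu d × ℝ | h p.1 ≤ (p.2 : EReal)} :=
      (hh.coe_toReal hy).ge
    exact hh.convex_epigraph hx' hy' ha hb hab
  refine ⟨fun x hx y hy a b ha hb hab => ?_, fun x hx y hy a b ha hb hab => ?_⟩
  · exact (key hx hy ha hb hab).trans_lt (EReal.coe_lt_top _)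
  · have hk := key hx hy ha hb hab
    have hm : a • x + b • y ∈ effDom h := hk.trans_lt (EReal.coe_lt_top _)
    rw [← hh.coe_toReal hm] at hk
    exact EReal.coe_le_coe_iff.1 hk

theorem IsProperConvex.continuousOn_toReal (hh : IsProperConvex h) :
    ContinuousOn (fun z => (h z).toReal) (interior (effDom h)) :=
  hh.convexOn_toReal.continuousOn_interior

theorem IsProperConvex.subgradient_ineq (hh : IsProperConvex h) {x z s : Eu d}
    (hx : x ∈ effDom h) (hz : z ∈ effDom h) (hs : s ∈ subdiff h x) :
    (h x).toReal + inner ℝ s (z - x) ≤ (h z).toReal := by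
  have hsz := hs z
  rw [← hh.coe_toReal hx, ← hh.coe_toReal hz, ← EReal.coe_add] at hsz
  exact EReal.coe_le_coe_iff.1 hsz

/-- Subgradients are bounded, uniformly on compact subsets of the interior of the domain. -/
theorem IsProperConvex.exists_subgradient_bound (hh : IsProperConvex h) {K : Set (Eu d)}
    (hK : IsCompact K) (hKh : K ⊆ interior (effDom h)) :
    ∃ L : ℝ, 0 ≤ L ∧ ∀ x ∈ K, ∀ s ∈ subdiff h x, ‖s‖ ≤ L := by
  obtain ⟨r, hr, hrK⟩ := hK.exists_cthickening_subset_open isOpen_interior hKh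
  obtain ⟨M, hM⟩ := (hK.cthickening (r := r)).exists_bound_of_continuousOn
    (hh.continuousOn_toReal.mono hrK)
  have hM' : ∀ z ∈ Metric.cthickening r K, |(h z).toReal| ≤ M := hM
  refine ⟨max (2 * M / r) 0, le_max_right _ _, fun x hx s hs => ?_⟩
  rcases eq_or_ne s 0 with rfl | hs0
  · simp
  refine le_max_of_le_left ?_
  -- The subgradient inequality is tested at distance `r` from `x` in the direction of `s`, which
  -- gives `r * ‖s‖ ≤ 2 * M`.
  have hns : 0 < ‖s‖ := norm_pos_iff.2 hs0
  have hxr : x ∈ Metric.cthickening r K := Metric.self_subset_cthickening K hx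
  have hzr : x + (r / ‖s‖) • s ∈ Metric.cthickening r K := by
    refine Metric.mem_cthickening_of_dist_le _ x r K hx ?_
    simp [norm_smul, abs_of_pos hr, div_mul_cancel₀ _ hns.ne']
  have hsub := hh.subgradient_ineq (interior_subset (hKh hx)) (interior_subset (hrK hzr)) hs
  rw [add_sub_cancel_left, inner_smul_right, real_inner_self_eq_norm_sq] at hsub
  have hrs : r / ‖s‖ * ‖s‖ ^ 2 = r * ‖s‖ := by field_simp
  have h1 := abs_le.1 (hM' _ hxr)
  have h2 := abs_le.1 (hM' _ hzr)
  rw [le_div_iff₀ hr]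
  linarith

/-- A hyperplane supports the epigraph at `(x, h x)`. It is not vertical, because a point directly
above lies in the interior of the epigraph; its slope is the subgradient. -/
theorem IsProperConvex.subdiff_nonempty (hh : IsProperConvex h) {x : Eu d}
    (hx : x ∈ interior (effDom h)) : (subdiff h x).Nonempty := by
  set E : Set (Eu d × ℝ) := {p | h p.1 ≤ (p.2 : EReal)} with hE
  have hxd := interior_subset hx
  have hcont : ContinuousAt (fun z => (h z).toReal) x :=
    hh.continuousOn_toReal.continuousAt (isOpen_interior.mem_nhds hx)
  have hint : (x, (h x).toReal + 1) ∈ interior E := by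
    rw [mem_interior_iff_mem_nhds]
    have h1 : ∀ᶠ p : Eu d × ℝ in nhds (x, (h x).toReal + 1), p.1 ∈ effDom h :=
      continuousAt_fst.eventually (mem_interior_iff_mem_nhds.1 hx)
    have h2 : ∀ᶠ p : Eu d × ℝ in nhds (x, (h x).toReal + 1), (h p.1).toReal < p.2 := by
      refine ContinuousAt.eventually_lt ?_ continuousAt_snd (by simp)
      exact ContinuousAt.comp (g := fun z => (h z).toReal) (by exact hcont) continuousAt_fst
    filter_upwards [h1, h2] with p hp1 hp2
    change h p.1 ≤ _
    rw [← hh.coe_toReal hp1]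
    exact EReal.coe_le_coe_iff.2 hp2.le
  have hnot : (x, (h x).toReal) ∉ interior E := by
    intro hmem
    have ht : Filter.Tendsto (fun ε : ℝ => (x, (h x).toReal - ε)) (nhds 0)
        (nhds (x, (h x).toReal)) := by
      have : Continuous fun ε : ℝ => (x, (h x).toReal - ε) := by fun_prop
      simpa using this.tendsto 0
    have hev := ht.eventually (mem_interior_iff_mem_nhds.1 hmem)
    obtain ⟨ε, hε, hpos⟩ := ((hev.filter_mono nhdsWithin_le_nhds).and
      (self_mem_nhdsWithin : ∀ᶠ ε in nhdsWithin (0 : ℝ) (Set.Ioi 0), ε ∈ Set.Ioi (0 : ℝ))).exists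
    have hε' : h x ≤ (((h x).toReal - ε : ℝ) : EReal) := hε
    rw [← hh.coe_toReal hxd] at hε'
    have := EReal.coe_le_coe_iff.1 hε'
    have hpos' : 0 < ε := hpos
    simp only [EReal.toReal_coe] at this
    linarith
  obtain ⟨F, hF⟩ := geometric_hahn_banach_open_point hh.convex_epigraph.interior isOpen_interior hnot
  -- Separation is strict only on the interior; it passes to all of `E` because a convex set with
  -- interior points lies in the closure of its interior.
  have hFle : ∀ p ∈ E, F p ≤ F (x, (h x).toReal) := by
    intro p hp
    have hcl : p ∈ closure (interior E) := by
      rw [hh.convex_epigraph.closure_interior_eq_closure_of_nonempty_interior ⟨_, hint⟩]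
      exact subset_closure hp
    exact closure_minimal (fun q hq => (hF q hq).le)
      (isClosed_le F.continuous continuous_const) hcl
  have hsplit : ∀ z r, F (z, r) = F (z, 0) + r * F (0, 1) := by
    intro z r
    rw [← smul_eq_mul, ← map_smul, ← map_add]
    simp
  have hc : F (0, 1) < 0 := by
    have := hF _ hint
    rw [hsplit x (_ + 1), hsplit x (h x).toReal] at this
    linarith
  set c := -F (0, 1) with hcdef
  have hcpos : 0 < c := by simpa [hcdef] using hc
  let ℓ : StrongDual ℝ (Eu d) := c⁻¹ • F.comp (ContinuousLinearMap.inl ℝ (Eu d) ℝ)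
  refine ⟨(InnerProductSpace.toDual ℝ (Eu d)).symm ℓ, fun z => ?_⟩
  by_cases hz : z ∈ effDom h
  · rw [InnerProductSpace.toDual_symm_apply, ← hh.coe_toReal hz, ← hh.coe_toReal hxd,
      ← EReal.coe_add, EReal.coe_le_coe_iff]
    have hzE : (z, (h z).toReal) ∈ E := (hh.coe_toReal hz).ge
    have hle := hFle _ hzE
    rw [hsplit z, hsplit x (h x).toReal] at hle
    have hℓ : ℓ (z - x) = c⁻¹ * (F (z, 0) - F (x, 0)) := by
      simp [ℓ, ← map_sub]
    rw [hℓ]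
    have : c⁻¹ * (F (z, 0) - F (x, 0)) ≤ (h z).toReal - (h x).toReal := by
      rw [inv_mul_le_iff₀ hcpos]
      linarith
    linarith
  · have : h z = ⊤ := not_lt_top_iff.1 hz
    simp [this]

end ConvexAnalysis

/-! ### Projections onto convex sets and onto the orthant -/

section Projections

theorem IsProjection.inner_le_zero {d : ℕ} {S : Set (Eu d)} (hS : Convex ℝ S) {z p : Eu d}
    (hp : IsProjection S z p) {q : Eu d} (hq : q ∈ S) : inner ℝ (z - p) (q - p) ≤ 0 := by
  refine (norm_eq_iInf_iff_real_inner_le_zero hS hp.1).1 ?_ q hq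
  have : Nonempty S := ⟨⟨p, hp.1⟩⟩
  refine le_antisymm (le_ciInf fun w => hp.2 w w.2) ?_
  exact ciInf_le ⟨0, by rintro _ ⟨w, rfl⟩; positivity⟩ (⟨p, hp.1⟩ : S)

theorem IsProjection.norm_sub_le {d : ℕ} {S : Set (Eu d)} (hS : Convex ℝ S) {z p : Eu d}
    (hp : IsProjection S z p) {q : Eu d} (hq : q ∈ S) : ‖p - q‖ ≤ ‖z - q‖ := by
  have h1 := hp.inner_le_zero hS hq
  have h2 : ‖z - q‖ ^ 2 = ‖z - p‖ ^ 2 - 2 * inner ℝ (z - p) (q - p) + ‖q - p‖ ^ 2 := by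
    rw [← norm_sub_sq_real, sub_sub_sub_cancel_right]
  rw [norm_sub_rev p q]
  refine le_of_sq_le_sq ?_ (norm_nonneg _)
  nlinarith [sq_nonneg ‖z - p‖]

variable {m : ℕ}

theorem orthantProj_nonneg (z : Eu m) (k : Fin m) : 0 ≤ orthantProj z k := le_max_right _ _

theorem norm_orthantProj_sub_le (z : Eu m) {u : Eu m} (hu : ∀ k, 0 ≤ u k) :
    ‖orthantProj z - u‖ ≤ ‖z - u‖ := by
  refine le_of_sq_le_sq ?_ (norm_nonneg _)
  rw [EuclideanSpace.norm_sq_eq, EuclideanSpace.norm_sq_eq]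
  refine sum_le_sum fun k _ => ?_
  simp only [PiLp.sub_apply, Real.norm_eq_abs, sq_abs, orthantProj]
  rcases le_total 0 (z k) with hz | hz
  · rw [max_eq_left hz]
  · rw [max_eq_right hz]
    nlinarith [hu k]

theorem norm_orthantProj_le (z : Eu m) : ‖orthantProj z‖ ≤ ‖z‖ := by
  simpa using norm_orthantProj_sub_le z (u := 0) (fun _ => le_rfl)

theorem inner_orthantProj_self (z : Eu m) : inner ℝ (orthantProj z) z = ‖orthantProj z‖ ^ 2 := by
  rw [EuclideanSpace.norm_sq_eq, PiLp.inner_apply]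
  refine sum_congr rfl fun k _ => ?_
  simp only [Real.norm_eq_abs, sq_abs, orthantProj, RCLike.inner_apply, conj_trivial]
  rcases le_total 0 (z k) with hz | hz
  · rw [max_eq_left hz]; ring
  · rw [max_eq_right hz]; ring

theorem inner_nonpos_of_nonneg_of_nonpos {u v : Eu m} (hu : ∀ k, 0 ≤ u k) (hv : ∀ k, v k ≤ 0) :
    inner ℝ u v ≤ 0 := by
  rw [PiLp.inner_apply]
  refine sum_nonpos fun k _ => ?_
  simpa using mul_nonpos_of_nonpos_of_nonneg (hv k) (hu k)

end Projections

/-! ### Averaging with doubly stochastic matrices over jointly connected graphs -/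

section Consensus

variable {N m : ℕ} {a : ℝ} {Q : ℕ} {G : ℕ → Digraph (Fin N)}
  {A : ℕ → Matrix (Fin N) (Fin N) ℝ}

theorem GraphAssumption.nonneg (hG : GraphAssumption a Q G A) (t : ℕ) (i j : Fin N) :
    0 ≤ A t i j := by
  by_cases h : (G t).Adj j i
  · exact (hG.weight_pos t i j h).le
  · exact (hG.weight_zero t i j h).ge

/-- Rows summing to at most one and columns summing to one force double stochasticity. -/
theorem GraphAssumption.row_sum_eq_one (hG : GraphAssumption a Q G A) (t : ℕ) (i : Fin N) :
    ∑ j, A t i j = 1 := by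
  have h : ∑ i, ∑ j, A t i j = ∑ _i : Fin N, (1 : ℝ) := by
    exact sum_comm.trans (sum_congr rfl fun j _ => hG.col_sum t j)
  exact (sum_eq_sum_iff_of_le fun i _ => hG.row_sum t i).1 h i (mem_univ i)

/-- The product `A (t + k - 1) * ⋯ * A t`. -/
def transition (A : ℕ → Matrix (Fin N) (Fin N) ℝ) (t : ℕ) : ℕ → Matrix (Fin N) (Fin N) ℝ
  | 0 => 1
  | k + 1 => A (t + k) * transition A t k

theorem transition_nonneg (hG : GraphAssumption a Q G A) (t k : ℕ) (i j : Fin N) :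
    0 ≤ transition A t k i j := by
  induction k generalizing i with
  | zero => simp only [transition, Matrix.one_apply]; split_ifs <;> norm_num
  | succ k ih =>
    rw [transition, Matrix.mul_apply]
    exact sum_nonneg fun l _ => mul_nonneg (hG.nonneg _ _ _) (ih l)

theorem transition_col_sum (hG : GraphAssumption a Q G A) (t k : ℕ) (j : Fin N) :
    ∑ i, transition A t k i j = 1 := by
  induction k with
  | zero => simp [transition, Matrix.one_apply]
  | succ k ih =>
    simp only [transition, Matrix.mul_apply]
    rw [sum_comm]
    simp only [← sum_mul, hG.col_sum, one_mul, ih]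

/-- The nodes reached from `j` along edges at times `t, …, t + k - 1`, in this order. -/
def reach (G : ℕ → Digraph (Fin N)) (t : ℕ) (j : Fin N) : ℕ → Set (Fin N)
  | 0 => {j}
  | k + 1 => {i | ∃ l ∈ reach G t j k, (G (t + k)).Adj l i}

/-- A single time-respecting path from `j` to `i` contributes a product of `k` weights, each at
least `a`; all other contributions are nonnegative. -/
theorem pow_le_transition (hG : GraphAssumption a Q G A) (ha : 0 < a) (t k : ℕ) {i j : Fin N}
    (hi : i ∈ reach G t j k) : a ^ k ≤ transition A t k i j := by
  induction k generalizing i with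
  | zero =>
    obtain rfl : i = j := hi
    simp [transition]
  | succ k ih =>
    obtain ⟨l, hl, hadj⟩ := hi
    rw [transition, Matrix.mul_apply, pow_succ']
    calc a * a ^ k ≤ A (t + k) i l * transition A t k l j :=
          mul_le_mul (hG.weight_ge _ _ _ (hG.weight_pos _ _ _ hadj)) (ih hl) (by positivity)
            (hG.nonneg _ _ _)
      _ ≤ _ := single_le_sum (f := fun l => A (t + k) i l * transition A t k l j)
          (fun l _ => mul_nonneg (hG.nonneg _ _ _) (transition_nonneg hG _ _ _ _)) (mem_univ l)

theorem reach_mono (hG : GraphAssumption a Q G A) (t : ℕ) (j : Fin N) :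
    Monotone (reach G t j) :=
  monotone_nat_of_le_succ fun k i hi => ⟨i, hi, hG.self_loop (t + k) i⟩

/-- If a window adds no node, the reached set is closed under the edges of the window graph, and
strong connectivity from `j` makes it everything. -/
theorem reach_eq_univ_of_stable (hG : GraphAssumption a Q G A) {t k : ℕ} (ht : 1 ≤ t) {j : Fin N}
    (hst : reach G t j (k + Q) = reach G t j k) : reach G t j k = Set.univ := by
  have hclosed : ∀ u v, (windowGraph G (t + k) Q).Adj u v → u ∈ reach G t j k →
      v ∈ reach G t j k := by
    rintro u v ⟨l, hl, hadj⟩ hu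
    rw [← hst]
    refine reach_mono hG t j (show k + l + 1 ≤ k + Q by omega) ?_
    exact ⟨u, reach_mono hG t j (Nat.le_add_right k l) hu, by rwa [← add_assoc]⟩
  have hj : j ∈ reach G t j k := reach_mono hG t j (Nat.zero_le k) rfl
  refine Set.eq_univ_of_forall fun v => ?_
  have hpath := hG.connected (t + k) (by omega) j v
  induction hpath with
  | refl => exact hj
  | tail _ hbc ih => exact hclosed _ _ hbc ih

theorem reach_eq_univ (hG : GraphAssumption a Q G A) {t : ℕ} (ht : 1 ≤ t) (j : Fin N) :
    reach G t j (N * Q) = Set.univ := by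
  -- Each window of length `Q` either adds a node or finds the set already full, so `N` windows
  -- suffice.
  have key : ∀ k, reach G t j (k * Q) = Set.univ ∨ k + 1 ≤ (reach G t j (k * Q)).ncard := by
    intro k
    induction k with
    | zero => right; simp [reach]
    | succ k ih =>
      have hsub : reach G t j (k * Q) ⊆ reach G t j (k * Q + Q) :=
        reach_mono hG t j (Nat.le_add_right _ _)
      rw [Nat.succ_mul]
      rcases ih with h | h
      · left
        exact Set.univ_subset_iff.1 (h ▸ hsub)
      · by_cases hst : reach G t j (k * Q + Q) = reach G t j (k * Q)
        · left
          rw [hst, reach_eq_univ_of_stable hG ht hst]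
        · right
          have := Set.ncard_lt_ncard (hsub.ssubset_of_ne (Ne.symm hst)) (Set.toFinite _)
          omega
  rcases key N with h | h
  · exact h
  · have := Set.ncard_le_card (reach G t j (N * Q))
    simp only [Nat.card_eq_fintype_card, Fintype.card_fin] at this
    omega

theorem pow_le_transition_window (hG : GraphAssumption a Q G A) (ha : 0 < a) {t : ℕ} (ht : 1 ≤ t)
    (i j : Fin N) : a ^ (N * Q) ≤ transition A t (N * Q) i j :=
  pow_le_transition hG ha t _ (by rw [reach_eq_univ hG ht]; trivial)

theorem norm_sum_smul_le {c : Fin N → ℝ} (hc : ∀ j, 0 ≤ c j) (z : Fin N → Eu m) :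
    ‖∑ j, c j • z j‖ ≤ ∑ j, c j * ‖z j‖ :=
  (norm_sum_le _ _).trans_eq <| sum_congr rfl fun j _ => by
    rw [norm_smul, Real.norm_eq_abs, abs_of_nonneg (hc j)]

theorem sum_norm_mix_le (hG : GraphAssumption a Q G A) (z : ℕ → Fin N → Eu m) (t : ℕ) :
    ∑ i, ‖mix A z t i‖ ≤ ∑ j, ‖z t j‖ := by
  calc ∑ i, ‖mix A z t i‖ ≤ ∑ i, ∑ j, A t i j * ‖z t j‖ :=
        sum_le_sum fun i _ => norm_sum_smul_le (hG.nonneg t i) _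
    _ = ∑ j, ‖z t j‖ := by
        rw [sum_comm]; simp only [← sum_mul, hG.col_sum, one_mul]

theorem norm_mix_le (hG : GraphAssumption a Q G A) {z : ℕ → Fin N → Eu m} {t : ℕ} {B : ℝ}
    (hz : ∀ j, ‖z t j‖ ≤ B) (i : Fin N) : ‖mix A z t i‖ ≤ B := by
  calc ‖mix A z t i‖ ≤ ∑ j, A t i j * ‖z t j‖ := norm_sum_smul_le (hG.nonneg t i) _
    _ ≤ ∑ j, A t i j * B :=
        sum_le_sum fun j _ => mul_le_mul_of_nonneg_left (hz j) (hG.nonneg t i j)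
    _ = B := by rw [← sum_mul, hG.row_sum_eq_one, one_mul]

theorem sum_mix (hG : GraphAssumption a Q G A) (z : ℕ → Fin N → Eu m) (t : ℕ) :
    ∑ i, mix A z t i = ∑ j, z t j := by
  simp only [mix]
  rw [sum_comm]
  simp only [← sum_smul, hG.col_sum, one_smul]

theorem mix_sub_const (hG : GraphAssumption a Q G A) (z : ℕ → Fin N → Eu m) (t : ℕ) (i : Fin N)
    (v : Eu m) : mix A z t i - v = mix A (fun t j => z t j - v) t i := by
  simp only [mix, smul_sub, sum_sub_distrib, ← sum_smul, hG.row_sum_eq_one, one_smul]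

/-- Squared distances to a fixed point do not increase under averaging. -/
theorem sum_norm_sq_mix_sub_le (hG : GraphAssumption a Q G A) (z : ℕ → Fin N → Eu m) (t : ℕ)
    (v : Eu m) : ∑ i, ‖mix A z t i - v‖ ^ 2 ≤ ∑ j, ‖z t j - v‖ ^ 2 := by
  calc ∑ i, ‖mix A z t i - v‖ ^ 2 ≤ ∑ i, ∑ j, A t i j * ‖z t j - v‖ ^ 2 := by
        refine sum_le_sum fun i _ => ?_
        rw [mix_sub_const hG]
        calc ‖mix A (fun t j => z t j - v) t i‖ ^ 2 ≤ (∑ j, A t i j * ‖z t j - v‖) ^ 2 := by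
              gcongr
              exact norm_sum_smul_le (hG.nonneg t i) _
          _ ≤ ∑ j, A t i j * ‖z t j - v‖ ^ 2 :=
              Real.pow_arith_mean_le_arith_mean_pow _ _ _ (fun j _ => hG.nonneg t i j)
                (hG.row_sum_eq_one t i) (fun _ _ => norm_nonneg _) 2
    _ = ∑ j, ‖z t j - v‖ ^ 2 := by
        rw [sum_comm]; simp only [← sum_mul, hG.col_sum, one_mul]

/-- The average of the agents' vectors. -/
noncomputable def average (z : Fin N → Eu m) : Eu m := (N : ℝ)⁻¹ • ∑ i, z i

/-- The total deviation of the agents' vectors from their average. -/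
noncomputable def dispersion (z : Fin N → Eu m) : ℝ := ∑ i, ‖z i - average z‖

theorem dispersion_nonneg (z : Fin N → Eu m) : 0 ≤ dispersion z :=
  sum_nonneg fun _ _ => norm_nonneg _

theorem sum_const_average (z : Fin N → Eu m) : ∑ _i : Fin N, average z = ∑ i, z i := by
  rcases Nat.eq_zero_or_pos N with rfl | hN
  · simp
  · have : (N : ℝ) ≠ 0 := by positivity
    rw [sum_const, card_univ, Fintype.card_fin, average, ← Nat.cast_smul_eq_nsmul ℝ, smul_smul,
      mul_inv_cancel₀ this, one_smul]

theorem sum_sub_average (z : Fin N → Eu m) : ∑ i, (z i - average z) = 0 := by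
  rw [sum_sub_distrib, sum_const_average, sub_self]

theorem sum_norm_average_le (z : Fin N → Eu m) : ∑ _i : Fin N, ‖average z‖ ≤ ∑ i, ‖z i‖ := by
  rcases Nat.eq_zero_or_pos N with rfl | hN
  · simp
  · have h0 : (N : ℝ) ≠ 0 := by positivity
    rw [sum_const, card_univ, Fintype.card_fin, average, nsmul_eq_mul, norm_smul, norm_inv,
      Real.norm_natCast, mul_inv_cancel_left₀ h0]
    exact norm_sum_le _ _

theorem dispersion_le (z : Fin N → Eu m) : dispersion z ≤ 2 * ∑ i, ‖z i‖ := by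
  calc dispersion z ≤ ∑ i, (‖z i‖ + ‖average z‖) := sum_le_sum fun i _ => norm_sub_le _ _
    _ ≤ _ := by rw [sum_add_distrib]; linarith [sum_norm_average_le z]

theorem sum_norm_mix_sub_average_le (hG : GraphAssumption a Q G A) (z : ℕ → Fin N → Eu m) (t : ℕ) :
    ∑ i, ‖mix A z t i - average (z t)‖ ≤ dispersion (z t) := by
  simp only [mix_sub_const hG]
  exact sum_norm_mix_le hG _ t

variable {z ε : ℕ → Fin N → Eu m}

theorem deviation_succ (hG : GraphAssumption a Q G A)
    (hz : ∀ t i, z (t + 1) i = mix A z t i + ε t i) (t : ℕ) (i : Fin N) :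
    z (t + 1) i - average (z (t + 1)) =
      (∑ j, A t i j • (z t j - average (z t))) + (ε t i - average (ε t)) := by
  have havg : average (z (t + 1)) = average (z t) + average (ε t) := by
    simp only [average, hz, sum_add_distrib, sum_mix hG, smul_add]
  have := mix_sub_const hG z t i (average (z t))
  rw [havg, hz]
  simp only [mix] at this ⊢
  rw [← this]
  abel

theorem dispersion_succ_le (hG : GraphAssumption a Q G A)
    (hz : ∀ t i, z (t + 1) i = mix A z t i + ε t i) (t : ℕ) :
    dispersion (z (t + 1)) ≤ dispersion (z t) + dispersion (ε t) := by
  simp only [dispersion, deviation_succ hG hz]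
  refine (sum_le_sum fun i _ => norm_add_le _ _).trans ?_
  rw [sum_add_distrib]
  exact add_le_add (sum_norm_mix_le hG (fun t j => z t j - average (z t)) t) le_rfl

/-- Averaging does not increase the sum of the norms, so each perturbation enters the later error at
most once, without amplification. -/
theorem sum_norm_deviation_sub_transition_le (hG : GraphAssumption a Q G A)
    (hz : ∀ t i, z (t + 1) i = mix A z t i + ε t i) (t k : ℕ) :
    ∑ i, ‖(z (t + k) i - average (z (t + k))) -
        ∑ j, transition A t k i j • (z t j - average (z t))‖
      ≤ ∑ s ∈ range k, dispersion (ε (t + s)) := by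
  induction k with
  | zero => simp [transition, Matrix.one_apply]
  | succ k ih =>
    rw [sum_range_succ]
    set r : ℕ → Fin N → Eu m := fun _ i => (z (t + k) i - average (z (t + k))) -
        ∑ j, transition A t k i j • (z t j - average (z t)) with hr
    have hstep : ∀ i, (z (t + (k + 1)) i - average (z (t + (k + 1)))) -
        ∑ j, transition A t (k + 1) i j • (z t j - average (z t))
        = mix A r (t + k) i + (ε (t + k) i - average (ε (t + k))) := by
      intro i
      rw [← add_assoc, deviation_succ hG hz]
      simp only [mix, hr, smul_sub _ (z (t + k) _ - average (z (t + k))), sum_sub_distrib]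
      have : ∑ j, transition A t (k + 1) i j • (z t j - average (z t)) =
          ∑ l, A (t + k) i l • ∑ j, transition A t k l j • (z t j - average (z t)) := by
        simp only [transition, Matrix.mul_apply, sum_smul, smul_sum, smul_smul]
        rw [sum_comm]
      rw [this]
      abel
    simp only [hstep]
    refine (sum_le_sum fun i _ => norm_add_le _ _).trans ?_
    rw [sum_add_distrib]
    exact add_le_add ((sum_norm_mix_le hG r (t + k)).trans ih) le_rfl

/-- Over a window of length `N * Q` the dispersion contracts, up to the perturbations. -/
theorem dispersion_window_le (hG : GraphAssumption a Q G A) (ha : 0 < a)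
    (hz : ∀ t i, z (t + 1) i = mix A z t i + ε t i) {t : ℕ} (ht : 1 ≤ t) :
    dispersion (z (t + N * Q)) ≤ (1 - a ^ (N * Q)) * dispersion (z t)
      + ∑ s ∈ range (N * Q), dispersion (ε (t + s)) := by
  set L := N * Q
  set η := a ^ L
  have hη : 0 < η := by positivity
  set e : Fin N → Eu m := fun j => z t j - average (z t) with he
  have hcontr : ∑ i, ‖∑ j, transition A t L i j • e j‖ ≤ (1 - η) * dispersion (z t) := by
    -- The deviations sum to zero, so the common lower bound `η` can be subtracted from every weight
    -- for free; the remaining weights are nonnegative with column sums `1 - N * η`.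
    have h1 : ∀ i, ∑ j, transition A t L i j • e j = ∑ j, (transition A t L i j - η) • e j := by
      intro i
      simp only [sub_smul, sum_sub_distrib, ← smul_sum]
      rw [show ∑ j, e j = 0 from sum_sub_average _, smul_zero, sub_zero]
    calc ∑ i, ‖∑ j, transition A t L i j • e j‖
        ≤ ∑ i, ∑ j, (transition A t L i j - η) * ‖e j‖ := by
          refine sum_le_sum fun i _ => ?_
          rw [h1]
          exact norm_sum_smul_le (fun j => sub_nonneg.2 (pow_le_transition_window hG ha ht i j)) _
      _ = ∑ j, (1 - N * η) * ‖e j‖ := by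
          rw [sum_comm]
          refine sum_congr rfl fun j _ => ?_
          rw [← sum_mul, sum_sub_distrib, transition_col_sum hG]
          simp
      _ ≤ ∑ j, (1 - η) * ‖e j‖ := by
          refine sum_le_sum fun j _ => ?_
          have hN : (1 : ℝ) ≤ N := by exact_mod_cast j.pos
          gcongr
          nlinarith
      _ = _ := by rw [← mul_sum]; rfl
  calc dispersion (z (t + L))
      ≤ ∑ i, (‖∑ j, transition A t L i j • e j‖
        + ‖(z (t + L) i - average (z (t + L))) - ∑ j, transition A t L i j • e j‖) := by
        refine sum_le_sum fun i _ => ?_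
        exact norm_le_insert' _ _
    _ ≤ _ := by
        rw [sum_add_distrib]
        exact add_le_add hcontr (sum_norm_deviation_sub_transition_le hG hz t L)

end Consensus

/-! ### Real recursions with window contraction, and summation by parts -/

section RealSequences

variable {E d : ℕ → ℝ} {L : ℕ} {η : ℝ}

theorem le_initial_add_of_le_add (hstep : ∀ t, E (t + 1) ≤ E t + d t) (hd : Antitone d) (t : ℕ) :
    E t ≤ E 0 + t * d 0 := by
  induction t with
  | zero => simp
  | succ t ih =>
    have := hd (Nat.zero_le t)
    push_cast
    linarith [hstep t]

/-- Up to time `L` the plain drift bound suffices. Later, the loss `η * (L * d 0 / η)` exactly pays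
for the perturbations of one window. -/
theorem le_of_window_contraction (hd : Antitone d) (hd0 : ∀ t, 0 ≤ d t)
    (hE : ∀ t, 0 ≤ E t) (hη : 0 < η) (hη1 : η ≤ 1) (hL : 0 < L)
    (hstep : ∀ t, E (t + 1) ≤ E t + d t)
    (hwin : ∀ t, 1 ≤ t → E (t + L) ≤ (1 - η) * E t + ∑ s ∈ range L, d (t + s)) (t : ℕ) :
    E t ≤ E 0 + L * d 0 + L * d 0 / η := by
  have hq : 0 ≤ L * d 0 / η := by have := hd0 0; positivity
  induction t using Nat.strong_induction_on with
  | _ t ih =>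
    rcases le_or_gt t L with h | h
    · have h1 := le_initial_add_of_le_add hstep hd t
      have h2 : (t : ℝ) * d 0 ≤ L * d 0 :=
        mul_le_mul_of_nonneg_right (by exact_mod_cast h) (hd0 0)
      linarith
    · obtain ⟨u, rfl⟩ : ∃ u, t = u + L := ⟨t - L, by omega⟩
      have h1 := hwin u (by omega)
      have h2 : ∑ s ∈ range L, d (u + s) ≤ L * d 0 := by
        refine (sum_le_card_nsmul _ _ (d 0) fun s _ => hd (Nat.zero_le _)).trans_eq ?_
        simp
      have h3 := mul_le_mul_of_nonneg_left (ih u (by omega)) (sub_nonneg.2 hη1)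
      have h4 : η * (L * d 0 / η) = L * d 0 := by field_simp
      have h5 : 0 ≤ η * (E 0 + L * d 0) := by have := hE 0; have := hd0 0; positivity
      nlinarith

/-- Summing the contraction bounds the sum shifted by `L` by `1 - η` times the original sum plus
perturbations. The two sums differ by at most the first `L` terms, so the factor `η` remains on the
left. -/
theorem sum_le_of_window_contraction (hd : Antitone d) (hd0 : ∀ t, 0 ≤ d t)
    (hE : ∀ t, 0 ≤ E t) (hstep : ∀ t, E (t + 1) ≤ E t + d t)
    (hwin : ∀ t, 1 ≤ t → E (t + L) ≤ (1 - η) * E t + ∑ s ∈ range L, d (t + s)) (T : ℕ) :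
    η * ∑ t ∈ range T, E (t + 1) ≤
      L * (E 0 + L * d 0) + L * ∑ t ∈ range T, d (t + 1) := by
  have h1 : ∑ t ∈ range T, E (t + 1) ≤ ∑ t ∈ range (L + T), E (t + 1) :=
    sum_le_sum_of_subset_of_nonneg (range_mono (Nat.le_add_left _ _)) fun _ _ _ => hE _
  rw [sum_range_add] at h1
  have h2 : ∑ t ∈ range L, E (t + 1) ≤ L * (E 0 + L * d 0) := by
    refine (sum_le_card_nsmul _ _ (E 0 + L * d 0) fun t ht => ?_).trans_eq (by simp [mul_add])
    refine (le_initial_add_of_le_add hstep hd (t + 1)).trans ?_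
    have : ((t + 1 : ℕ) : ℝ) ≤ L := by exact_mod_cast mem_range.1 ht
    have := mul_le_mul_of_nonneg_right this (hd0 0)
    linarith
  have h3 : ∑ t ∈ range T, E (L + t + 1) ≤
      (1 - η) * ∑ t ∈ range T, E (t + 1) + L * ∑ t ∈ range T, d (t + 1) := by
    rw [mul_sum, mul_sum, ← sum_add_distrib]
    refine sum_le_sum fun t _ => ?_
    have h4 := hwin (t + 1) (by omega)
    have h5 : ∑ s ∈ range L, d (t + 1 + s) ≤ L * d (t + 1) := by
      refine (sum_le_card_nsmul _ _ (d (t + 1)) fun s _ => hd (Nat.le_add_right _ _)).trans_eq ?_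
      simp
    rw [show L + t + 1 = t + 1 + L by omega]
    linarith
  linarith

/-- Summation by parts with nondecreasing weights. -/
theorem sum_mul_sub_succ_le {c V : ℕ → ℝ} {M : ℝ} {T : ℕ} (hc : Monotone c) (hc0 : ∀ t, 0 ≤ c t)
    (hV : ∀ t, 0 ≤ V t) (hM : ∀ t, 1 ≤ t → t ≤ T → V t ≤ M) (hM0 : 0 ≤ M) :
    ∑ t ∈ range T, c (t + 1) * (V (t + 1) - V (t + 2)) ≤ c T * M := by
  -- The bound `M` is known only up to index `T`, while `V (T + 1)` also occurs; the truncation by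
  -- `M` lets the induction reach `k = T`.
  have key : ∀ k, k ≤ T → ∑ t ∈ range k, c (t + 1) * (V (t + 1) - V (t + 2)) ≤
      c k * M - c k * min M (V (k + 1)) := by
    intro k
    induction k with
    | zero =>
      intro _
      simpa using mul_le_mul_of_nonneg_left (min_le_left M (V 1)) (hc0 0)
    | succ k ih =>
      intro hk
      have h1 := ih (by omega)
      have h2 : V (k + 1) ≤ M := hM _ (by omega) hk
      rw [min_eq_right h2] at h1
      rw [sum_range_succ]
      have h3 := mul_le_mul_of_nonneg_right (hc (Nat.le_succ k)) (sub_nonneg.2 h2)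
      have h4 := mul_le_mul_of_nonneg_left (min_le_right M (V (k + 1 + 1))) (hc0 (k + 1))
      simp only [Nat.succ_eq_add_one] at h3
      have : V (k + 2) = V (k + 1 + 1) := rfl
      nlinarith
  refine (key T le_rfl).trans ?_
  have : 0 ≤ c T * min M (V (T + 1)) := mul_nonneg (hc0 T) (le_min hM0 (hV _))
  linarith

end RealSequences

/-! ### Sums and monotonicity of the stepsizes -/

section Stepsizes

theorem alpha_pos (t : ℕ) : 0 < alpha t := by
  unfold alpha
  split_ifs with h
  · norm_num
  · have : (0 : ℝ) < t := by exact_mod_cast Nat.pos_of_ne_zero h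
    positivity

theorem alpha_antitone : Antitone alpha := by
  refine antitone_nat_of_succ_le fun t => ?_
  unfold alpha
  rw [if_neg (Nat.succ_ne_zero t)]
  split_ifs with h
  · simp [h]
  · have : (0 : ℝ) < t := by exact_mod_cast Nat.pos_of_ne_zero h
    push_cast
    gcongr
    linarith

theorem alpha_zero : alpha 0 = 1 := if_pos rfl

theorem inv_alpha {t : ℕ} (ht : t ≠ 0) : (alpha t)⁻¹ = Real.sqrt t := by
  rw [alpha, if_neg ht, one_div, inv_inv]

theorem sum_alpha_le (T : ℕ) : ∑ t ∈ range T, alpha (t + 1) ≤ 2 * Real.sqrt T := by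
  induction T with
  | zero => simp
  | succ T ih =>
    rw [sum_range_succ, alpha, if_neg (Nat.succ_ne_zero T)]
    set p := Real.sqrt T
    set q := Real.sqrt ((T + 1 : ℕ) : ℝ) with hq
    have hqpos : 0 < q := Real.sqrt_pos.2 (by positivity)
    have hp2 : p ^ 2 = T := Real.sq_sqrt (by positivity)
    have hq2 : q ^ 2 = T + 1 := by rw [hq, Real.sq_sqrt (by positivity)]; push_cast; ring
    -- Since `q ^ 2 - p ^ 2 = 1`, this is `(q - p) ^ 2 ≥ 0`, and the right-hand side telescopes.
    have : 1 / q ≤ 2 * (q - p) := by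
      rw [div_le_iff₀ hqpos]
      nlinarith [sq_nonneg (q - p)]
    linarith

variable {κ : ℝ}

theorem beta_pos (κ : ℝ) (t : ℕ) : 0 < beta κ t := by
  unfold beta
  split_ifs with h
  · norm_num
  · have : (0 : ℝ) < t := by exact_mod_cast Nat.pos_of_ne_zero h
    positivity

theorem beta_antitone (hκ : 0 < κ) : Antitone (beta κ) := by
  refine antitone_nat_of_succ_le fun t => ?_
  unfold beta
  rw [if_neg (Nat.succ_ne_zero t)]
  split_ifs with h
  · simp [h]
  · have : (0 : ℝ) < t := by exact_mod_cast Nat.pos_of_ne_zero h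
    push_cast
    gcongr
    linarith

theorem alpha_mul_beta_le_one (hκ : 0 < κ) (t : ℕ) : alpha t * beta κ t ≤ 1 := by
  have h1 : alpha t ≤ 1 := alpha_zero ▸ alpha_antitone (Nat.zero_le t)
  have h2 : beta κ t ≤ 1 := by simpa [beta] using beta_antitone hκ (Nat.zero_le t)
  exact mul_le_one₀ h1 (beta_pos κ t).le h2

theorem beta_le_one (hκ : 0 < κ) (t : ℕ) : beta κ t ≤ 1 := by
  simpa [beta] using beta_antitone hκ (Nat.zero_le t)

theorem inv_beta_sq {t : ℕ} (ht : t ≠ 0) : (beta κ t)⁻¹ ^ 2 = (t : ℝ) ^ (2 * κ) := by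
  rw [beta, if_neg ht, one_div, inv_inv, ← Real.rpow_natCast, ← Real.rpow_mul (by positivity)]
  congr 1
  push_cast
  ring

theorem beta_eq_alpha_mul {t : ℕ} (ht : t ≠ 0) : beta κ t = alpha t * (t : ℝ) ^ (1 / 2 - κ) := by
  have h : (0 : ℝ) < t := by exact_mod_cast Nat.pos_of_ne_zero ht
  rw [beta, alpha, if_neg ht, if_neg ht, Real.sqrt_eq_rpow, one_div, one_div,
    ← Real.rpow_neg h.le, ← Real.rpow_neg h.le, ← Real.rpow_add h]
  congr 1
  ring

theorem sum_beta_le (hκ : κ < 1 / 4) {T : ℕ} (hT : 1 ≤ T) :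
    ∑ t ∈ range T, beta κ (t + 1) ≤ 2 * (T : ℝ) ^ (1 - κ) := by
  have hT' : (0 : ℝ) < T := by exact_mod_cast hT
  calc ∑ t ∈ range T, beta κ (t + 1)
      ≤ ∑ t ∈ range T, alpha (t + 1) * (T : ℝ) ^ (1 / 2 - κ) := by
        refine sum_le_sum fun t ht => ?_
        rw [beta_eq_alpha_mul (Nat.succ_ne_zero t)]
        have : ((t + 1 : ℕ) : ℝ) ≤ T := by exact_mod_cast mem_range.1 ht
        have := alpha_pos (t + 1)
        gcongr
        linarith
    _ ≤ 2 * Real.sqrt T * (T : ℝ) ^ (1 / 2 - κ) := by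
        rw [← sum_mul]
        gcongr
        exact sum_alpha_le T
    _ = 2 * (T : ℝ) ^ (1 - κ) := by
        rw [mul_assoc, Real.sqrt_eq_rpow, ← Real.rpow_add hT']
        congr 2
        ring

end Stepsizes

/-! ### Subgradients of the local Lagrangians -/

section LagrangianSubgradients

variable {d m : ℕ} {φ : Eu d → EReal} {h : Eu d → Fin m → EReal} {x z s : Eu d} {ν : Eu m}

theorem lagrangian_sub_le_inner (hφ : IsProperConvex φ) (hh : ∀ k, IsProperConvex fun z => h z k)
    (hxφ : x ∈ effDom φ) (hzφ : z ∈ effDom φ) (hxh : ∀ k, x ∈ effDom fun z => h z k)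
    (hzh : ∀ k, z ∈ effDom fun z => h z k) (hν : ∀ k, 0 ≤ ν k)
    (hs : s ∈ lagrangianSubdiff φ h x ν) :
    (φ x).toReal - (φ z).toReal + inner ℝ ν (realVec h x - realVec h z) ≤ inner ℝ s (x - z) := by
  obtain ⟨p, hp, q, hq, rfl⟩ := hs
  have h1 := hφ.subgradient_ineq hxφ hzφ hp
  rw [← neg_sub x z, inner_neg_right] at h1
  have h2 : inner ℝ ν (realVec h x - realVec h z) ≤ inner ℝ (∑ k, ν k • q k) (x - z) := by
    rw [sum_inner, PiLp.inner_apply]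
    refine sum_le_sum fun k _ => ?_
    have h3 := (hh k).subgradient_ineq (hxh k) (hzh k) (hq k)
    rw [← neg_sub x z, inner_neg_right] at h3
    rw [real_inner_smul_left]
    simp only [RCLike.inner_apply, conj_trivial, realVec, PiLp.sub_apply]
    rw [mul_comm]
    exact mul_le_mul_of_nonneg_left (by linarith) (hν k)
  rw [inner_add_left]
  linarith

theorem norm_le_of_mem_lagrangianSubdiff {Cf Lg : ℝ} (hLg : 0 ≤ Lg)
    (hφ : ∀ p ∈ subdiff φ x, ‖p‖ ≤ Cf) (hh : ∀ k, ∀ q ∈ subdiff (fun z => h z k) x, ‖q‖ ≤ Lg)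
    (hs : s ∈ lagrangianSubdiff φ h x ν) : ‖s‖ ≤ Cf + m * Lg * ‖ν‖ := by
  obtain ⟨p, hp, q, hq, rfl⟩ := hs
  refine (norm_add_le _ _).trans (add_le_add (hφ p hp) ?_)
  calc ‖∑ k, ν k • q k‖ ≤ ∑ _k : Fin m, Lg * ‖ν‖ := by
        refine (norm_sum_le _ _).trans (sum_le_sum fun k _ => ?_)
        rw [norm_smul, mul_comm]
        exact mul_le_mul (hh k _ (hq k)) (PiLp.norm_apply_le ν k) (norm_nonneg _) hLg
    _ = m * Lg * ‖ν‖ := by simp [mul_assoc]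

end LagrangianSubgradients

/-! ### A priori bounds on weights, trackers and multipliers -/

section Runs

variable {N m : ℕ} {n : Fin N → ℕ} {X : ∀ i, Set (Eu (n i))} {g : ∀ i, Eu (n i) → Fin m → EReal}
  {f : ℕ → ∀ i, Eu (n i) → EReal} {a κ : ℝ} {Q : ℕ} {G : ℕ → Digraph (Fin N)}
  {A : ℕ → Matrix (Fin N) (Fin N) ℝ} {S : Iterates N m n}

theorem IsRun.w_eq_one (hS : IsRun X g f A κ S) (hG : GraphAssumption a Q G A) (t : ℕ)
    (i : Fin N) : S.w t i = 1 := by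
  induction t generalizing i with
  | zero => exact hS.w_zero i
  | succ t ih => rw [hS.w_succ]; simp only [ih, mul_one, hG.row_sum_eq_one]

theorem IsRun.x_mem (hS : IsRun X g f A κ S) (t : ℕ) (i : Fin N) : S.x t i ∈ X i := by
  cases t with
  | zero => exact hS.x_zero i
  | succ t => exact (hS.x_succ t i).1

theorem IsRun.μ_nonneg (hS : IsRun X g f A κ S) (t : ℕ) (i : Fin N) (k : Fin m) :
    0 ≤ S.μ t i k := by
  cases t with
  | zero => simp [hS.μ_zero]
  | succ t => rw [hS.μ_succ]; exact orthantProj_nonneg _ k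

theorem IsRun.mix_μ_nonneg (hS : IsRun X g f A κ S) (hG : GraphAssumption a Q G A) (t : ℕ)
    (i : Fin N) (k : Fin m) : 0 ≤ mix A S.μ t i k := by
  simp only [mix, WithLp.ofLp_sum, WithLp.ofLp_smul, Finset.sum_apply, Pi.smul_apply, smul_eq_mul]
  exact sum_nonneg fun j _ => mul_nonneg (hG.nonneg t i j) (hS.μ_nonneg t j k)

theorem IsRun.μ_succ_eq (hS : IsRun X g f A κ S) (hG : GraphAssumption a Q G A) (t : ℕ)
    (i : Fin N) : S.μ (t + 1) i = orthantProj (mix A S.μ t i +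
      alpha t • (mix A S.y t i - beta κ t • mix A S.μ t i)) := by
  simp [hS.μ_succ, hS.w_eq_one hG]

theorem IsRun.s_succ_mem (hS : IsRun X g f A κ S) (hG : GraphAssumption a Q G A) (t : ℕ)
    (i : Fin N) :
    S.s (t + 1) i ∈ lagrangianSubdiff (f t i) (g i) (S.x t i) (mix A S.μ t i) := by
  simpa [hS.w_eq_one hG] using hS.s_succ t i

/-- The trackers sum to the current total constraint value. -/
theorem IsRun.sum_y (hS : IsRun X g f A κ S) (hG : GraphAssumption a Q G A) (t : ℕ) :
    ∑ i, S.y t i = ∑ i, realVec (g i) (S.x t i) := by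
  induction t with
  | zero => simp only [hS.y_zero]
  | succ t ih =>
    simp only [hS.y_succ, sum_add_distrib, sum_mix hG, ih, sum_sub_distrib]
    abel

/-- The trackers are bounded, uniformly over all runs. -/
theorem exists_tracker_bound (X : ∀ i, Set (Eu (n i))) (g : ∀ i, Eu (n i) → Fin m → EReal)
    {B : ℝ} (hB : 0 ≤ B) (hgB : ∀ i, ∀ x ∈ X i, ‖realVec (g i) x‖ ≤ B)
    (ha0 : 0 < a) (ha1 : a < 1) (hQ : 0 < Q) (κ : ℝ) :
    ∃ Y : ℝ, 0 ≤ Y ∧ ∀ (f : ℕ → ∀ i, Eu (n i) → EReal) (G : ℕ → Digraph (Fin N))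
      (A : ℕ → Matrix (Fin N) (Fin N) ℝ), GraphAssumption a Q G A →
      ∀ S : Iterates N m n, IsRun X g f A κ S → ∀ t i, ‖S.y t i‖ ≤ Y := by
  set L := N * Q with hL
  set d : ℝ := 2 * (N * (2 * B)) with hd
  have hd0 : 0 ≤ d := by positivity
  refine ⟨2 * (N * B) + L * d + L * d / a ^ L + B, by positivity, fun f G A hG S hS t i => ?_⟩
  have hgx : ∀ t i, ‖realVec (g i) (S.x t i)‖ ≤ B := fun t i => hgB i _ (hS.x_mem t i)
  set ε : ℕ → Fin N → Eu m := fun t i => realVec (g i) (S.x (t + 1) i) - realVec (g i) (S.x t i)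
    with hε
  have hεd : ∀ t, dispersion (ε t) ≤ d := by
    intro t
    refine (dispersion_le _).trans ?_
    rw [hd]
    gcongr
    refine (sum_le_card_nsmul _ _ (2 * B) fun i _ => ?_).trans_eq (by simp)
    exact (norm_sub_le _ _).trans (by linarith [hgx (t + 1) i, hgx t i])
  have hE0 : dispersion (S.y 0) ≤ 2 * (N * B) := by
    refine (dispersion_le _).trans ?_
    gcongr
    refine (sum_le_card_nsmul _ _ B fun i _ => ?_).trans_eq (by simp)
    rw [hS.y_zero]
    exact hgx 0 i
  have hrec : ∀ t i, S.y (t + 1) i = mix A S.y t i + ε t i := hS.y_succ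
  have hdisp : dispersion (S.y t) ≤ dispersion (S.y 0) + L * d + L * d / a ^ L := by
    refine le_of_window_contraction (E := fun t => dispersion (S.y t)) (d := fun _ => d) (L := L)
      antitone_const (fun _ => hd0) (fun _ => dispersion_nonneg _) (by positivity)
      (pow_le_one₀ ha0.le ha1.le) (Nat.mul_pos i.pos hQ)
      (fun t => (dispersion_succ_le hG hrec t).trans (by linarith [hεd t])) (fun t ht => ?_) t
    exact (dispersion_window_le hG ha0 hrec ht).trans
      (add_le_add le_rfl (sum_le_sum fun s _ => hεd _))
  -- Contraction controls only deviations; the average is controlled by conservation of the sum of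
  -- the trackers.
  have havg : ‖average (S.y t)‖ ≤ B := by
    have hN : (0 : ℝ) < N := by exact_mod_cast i.pos
    rw [average, hS.sum_y hG, norm_smul, norm_inv, Real.norm_natCast, inv_mul_le_iff₀ hN]
    refine (norm_sum_le _ _).trans ?_
    exact (sum_le_card_nsmul _ _ B fun i _ => hgx t i).trans_eq (by simp)
  have hdev : ‖S.y t i - average (S.y t)‖ ≤ dispersion (S.y t) :=
    single_le_sum (f := fun i => ‖S.y t i - average (S.y t)‖) (fun _ _ => norm_nonneg _)
      (mem_univ i)
  have := norm_le_insert' (S.y t i) (average (S.y t))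
  linarith

variable {Y : ℝ}

/-- The penalty term keeps the multipliers of order `1 / β t`. -/
theorem IsRun.norm_μ_le (hS : IsRun X g f A κ S) (hG : GraphAssumption a Q G A) (hκ : 0 < κ)
    (hY : 0 ≤ Y) (hy : ∀ t i, ‖S.y t i‖ ≤ Y) (t : ℕ) (i : Fin N) :
    ‖S.μ t i‖ ≤ Y * (beta κ t)⁻¹ := by
  induction t generalizing i with
  | zero => simp [hS.μ_zero, beta, hY]
  | succ t ih =>
    have hα := alpha_pos t
    have hβ := beta_pos κ t
    have hμ := norm_mix_le hG ih i
    have hyi := norm_mix_le hG (hy t) i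
    have h1 : 0 ≤ 1 - alpha t * beta κ t := sub_nonneg.2 (alpha_mul_beta_le_one hκ t)
    calc ‖S.μ (t + 1) i‖
        ≤ ‖mix A S.μ t i + alpha t • (mix A S.y t i - beta κ t • mix A S.μ t i)‖ := by
          rw [hS.μ_succ_eq hG]; exact norm_orthantProj_le _
      -- The leak makes `Y / β t` a fixed point of the scalar recursion, since `(1 - α β) (Y / β) +
      -- α Y = Y / β`; it then grows with `t` because `β` decreases.
      _ = ‖(1 - alpha t * beta κ t) • mix A S.μ t i + alpha t • mix A S.y t i‖ := by
          congr 1; module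
      _ ≤ (1 - alpha t * beta κ t) * ‖mix A S.μ t i‖ + alpha t * ‖mix A S.y t i‖ := by
          refine (norm_add_le _ _).trans_eq ?_
          rw [norm_smul, norm_smul, Real.norm_of_nonneg h1, Real.norm_of_nonneg hα.le]
      _ ≤ (1 - alpha t * beta κ t) * (Y * (beta κ t)⁻¹) + alpha t * Y := by gcongr
      _ = Y * (beta κ t)⁻¹ := by field_simp; ring
      _ ≤ Y * (beta κ (t + 1))⁻¹ := by
          have := beta_pos κ (t + 1)
          gcongr
          exact beta_antitone hκ (Nat.le_succ t)

theorem IsRun.norm_dual_step_le (hS : IsRun X g f A κ S) (hG : GraphAssumption a Q G A)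
    (hκ : 0 < κ) (hY : 0 ≤ Y) (hy : ∀ t i, ‖S.y t i‖ ≤ Y) (t : ℕ) (i : Fin N) :
    ‖mix A S.y t i - beta κ t • mix A S.μ t i‖ ≤ 2 * Y := by
  have hβ := beta_pos κ t
  have hμ := norm_mix_le hG (hS.norm_μ_le hG hκ hY hy t) i
  have hyi := norm_mix_le hG (hy t) i
  have h : beta κ t * ‖mix A S.μ t i‖ ≤ Y := by
    calc _ ≤ beta κ t * (Y * (beta κ t)⁻¹) := by gcongr
      _ = Y := by field_simp
  refine (norm_sub_le _ _).trans ?_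
  rw [norm_smul, Real.norm_of_nonneg hβ.le]
  linarith

/-- The accumulated disagreement of the multipliers is of order `√T`. -/
theorem exists_sum_dispersion_μ_le (N Q : ℕ) (ha0 : 0 < a) (hY : 0 ≤ Y) :
    ∃ D : ℝ, 0 ≤ D ∧ ∀ {m : ℕ} {n : Fin N → ℕ} {X : ∀ i, Set (Eu (n i))}
      {g : ∀ i, Eu (n i) → Fin m → EReal} {f : ℕ → ∀ i, Eu (n i) → EReal}
      {G : ℕ → Digraph (Fin N)} {A : ℕ → Matrix (Fin N) (Fin N) ℝ} {κ : ℝ} {S : Iterates N m n},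
      0 < κ → GraphAssumption a Q G A → IsRun X g f A κ S → (∀ t i, ‖S.y t i‖ ≤ Y) →
      ∀ T : ℕ, 1 ≤ T → ∑ t ∈ range T, dispersion (S.μ (t + 1)) ≤ D * Real.sqrt T := by
  set L := N * Q with hL
  set c : ℝ := 2 * (N * (2 * Y)) with hc
  have hc0 : 0 ≤ c := by positivity
  refine ⟨(L * (L * c) + L * (c * 2)) / a ^ L, by positivity, ?_⟩
  intro m n X g f G A κ S hκ hG hS hy T hT
  -- The perturbation includes the effect of the projection. As the averaged multiplier is itself
  -- nonnegative, projecting cannot increase its distance to it beyond the length of the dual step.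
  set ε : ℕ → Fin N → Eu m := fun t i => S.μ (t + 1) i - mix A S.μ t i with hε
  have hεd : ∀ t, dispersion (ε t) ≤ c * alpha t := by
    intro t
    refine (dispersion_le _).trans ?_
    rw [hc, mul_assoc, mul_assoc]
    gcongr
    refine (sum_le_card_nsmul _ _ (2 * Y * alpha t) fun i _ => ?_).trans_eq (by simp)
    simp only [hε]
    rw [hS.μ_succ_eq hG]
    refine (norm_orthantProj_sub_le _ (hS.mix_μ_nonneg hG t i)).trans ?_
    rw [add_sub_cancel_left, norm_smul, Real.norm_of_nonneg (alpha_pos t).le, mul_comm]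
    exact mul_le_mul_of_nonneg_right (hS.norm_dual_step_le hG hκ hY hy t i) (alpha_pos t).le
  have hrec : ∀ t i, S.μ (t + 1) i = mix A S.μ t i + ε t i := fun t i => by simp [hε]
  have hanti : Antitone fun t => c * alpha t :=
    fun s t hst => mul_le_mul_of_nonneg_left (alpha_antitone hst) hc0
  have hE0 : dispersion (S.μ 0) = 0 := by simp [dispersion, average, hS.μ_zero]
  have key := sum_le_of_window_contraction (E := fun t => dispersion (S.μ t))
    (d := fun t => c * alpha t) (L := L) (η := a ^ L) hanti
    (fun t => mul_nonneg hc0 (alpha_pos t).le) (fun _ => dispersion_nonneg _)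
    (fun t => (dispersion_succ_le hG hrec t).trans (by linarith [hεd t]))
    (fun t ht => (dispersion_window_le hG ha0 hrec ht).trans
      (add_le_add le_rfl (sum_le_sum fun s _ => hεd _))) T
  simp only [hE0, zero_add, alpha_zero, mul_one, ← mul_sum] at key
  have hR : 1 ≤ Real.sqrt T := Real.one_le_sqrt.2 (by exact_mod_cast hT)
  have h1 : (L : ℝ) * (L * c) ≤ L * (L * c) * Real.sqrt T :=
    le_mul_of_one_le_right (by positivity) hR
  have h2 : (L : ℝ) * (c * ∑ t ∈ range T, alpha (t + 1)) ≤ L * (c * (2 * Real.sqrt T)) := by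
    gcongr
    exact sum_alpha_le T
  rw [div_mul_eq_mul_div, le_div_iff₀ (by positivity)]
  linarith

end Runs

/-! ### Energy inequality and its consequences -/

section RegretAnalysis

variable {N m : ℕ} {n : Fin N → ℕ} {X : ∀ i, Set (Eu (n i))} {g : ∀ i, Eu (n i) → Fin m → EReal}
  {f : ℕ → ∀ i, Eu (n i) → EReal} {a κ B Cf Y : ℝ} {Q : ℕ} {G : ℕ → Digraph (Fin N)}
  {A : ℕ → Matrix (Fin N) (Fin N) ℝ} {S : Iterates N m n}

theorem IsRun.primal_step_le (hS : IsRun X g f A κ S) (hG : GraphAssumption a Q G A)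
    (hX : ∀ i, Convex ℝ (X i)) (hg : ∀ i k, IsProperConvex fun z => g i z k)
    (hgX : ∀ i k, X i ⊆ interior (effDom fun z => g i z k)) (hf : CostAssumption X Cf f)
    (t : ℕ) (i : Fin N) {z : Eu (n i)} (hz : z ∈ X i) :
    2 * alpha t * ((f t i (S.x t i)).toReal - (f t i z).toReal
        + inner ℝ (mix A S.μ t i) (realVec (g i) (S.x t i) - realVec (g i) z)) ≤
      ‖S.x t i - z‖ ^ 2 - ‖S.x (t + 1) i - z‖ ^ 2 + alpha t ^ 2 * ‖S.s (t + 1) i‖ ^ 2 := by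
  have hx := hS.x_mem t i
  have h1 := lagrangian_sub_le_inner (hf.convex t i) (hg i)
    (interior_subset (hf.finite_near t i hx)) (interior_subset (hf.finite_near t i hz))
    (fun k => interior_subset (hgX i k hx)) (fun k => interior_subset (hgX i k hz))
    (hS.mix_μ_nonneg hG t i) (hS.s_succ_mem hG t i)
  have h2 : ‖S.x (t + 1) i - z‖ ^ 2 ≤ ‖(S.x t i - z) - alpha t • S.s (t + 1) i‖ ^ 2 := by
    rw [sub_right_comm]
    gcongr
    exact (hS.x_succ t i).norm_sub_le (hX i) hz
  rw [norm_sub_sq_real (S.x t i - z), inner_smul_right, norm_smul, mul_pow, Real.norm_eq_abs,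
    sq_abs, real_inner_comm] at h2
  have h3 := mul_le_mul_of_nonneg_left h1 (alpha_pos t).le
  linarith

/-- Projection onto the orthant brings the multiplier no farther from `ν ≥ 0`. The penalty
contributes `-2 α β (‖u‖² - ⟨ν, u⟩)` with `u` the averaged multiplier, which is at most `α β ‖ν‖²`.
-/
theorem IsRun.dual_step_le (hS : IsRun X g f A κ S) (hG : GraphAssumption a Q G A) (hκ : 0 < κ)
    (hY : 0 ≤ Y) (hy : ∀ t i, ‖S.y t i‖ ≤ Y) (t : ℕ) (i : Fin N) {ν : Eu m}
    (hν : ∀ k, 0 ≤ ν k) :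
    2 * alpha t * (inner ℝ ν (mix A S.y t i) - inner ℝ (mix A S.μ t i) (mix A S.y t i)) ≤
      ‖mix A S.μ t i - ν‖ ^ 2 - ‖S.μ (t + 1) i - ν‖ ^ 2 + alpha t ^ 2 * (2 * Y) ^ 2
        + alpha t * beta κ t * ‖ν‖ ^ 2 := by
  set u := mix A S.μ t i with hu
  set v := mix A S.y t i with hv
  have hα := alpha_pos t
  have hβ := beta_pos κ t
  have h1 : ‖S.μ (t + 1) i - ν‖ ^ 2 ≤ ‖(u - ν) + alpha t • (v - beta κ t • u)‖ ^ 2 := by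
    rw [hS.μ_succ_eq hG, ← hu, ← hv, sub_add_eq_add_sub]
    gcongr
    exact norm_orthantProj_sub_le _ hν
  have h2 : ‖v - beta κ t • u‖ ^ 2 ≤ (2 * Y) ^ 2 := by
    gcongr
    exact hS.norm_dual_step_le hG hκ hY hy t i
  rw [norm_add_sq_real, inner_smul_right, norm_smul, mul_pow, Real.norm_eq_abs, sq_abs] at h1
  have h3 : inner ℝ (u - ν) (v - beta κ t • u) =
      inner ℝ u v - inner ℝ ν v - beta κ t * (‖u‖ ^ 2 - inner ℝ ν u) := by
    rw [inner_sub_left, inner_sub_right, inner_sub_right, inner_smul_right, inner_smul_right,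
      real_inner_self_eq_norm_sq]
    ring
  rw [h3] at h1
  have h4 : 2 * inner ℝ ν u ≤ ‖ν‖ ^ 2 + ‖u‖ ^ 2 := by
    have := sq_nonneg ‖ν - u‖
    rw [norm_sub_sq_real] at this
    linarith
  have h5 := mul_le_mul_of_nonneg_left h2 (sq_nonneg (alpha t))
  have h6 : 0 ≤ alpha t * beta κ t * (‖ν‖ ^ 2 + 2 * ‖u‖ ^ 2 - 2 * inner ℝ ν u) := by
    have := sq_nonneg ‖u‖
    exact mul_nonneg (by positivity) (by linarith)
  linarith

/-- The squared distance of the primal-dual iterates to `(z, (ν, …, ν))`. -/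
noncomputable def energy (S : Iterates N m n) (z : ∀ i, Eu (n i)) (ν : Eu m) (t : ℕ) : ℝ :=
  ∑ i, ‖S.x t i - z i‖ ^ 2 + ∑ i, ‖S.μ t i - ν‖ ^ 2

theorem energy_nonneg (S : Iterates N m n) (z : ∀ i, Eu (n i)) (ν : Eu m) (t : ℕ) :
    0 ≤ energy S z ν t := by
  unfold energy
  positivity

/-- In the sum of the primal and dual inequalities, the `ν` terms see only the sum of the trackers,
which is exact. The mismatch between trackers and local constraint values meets only the
multipliers, and is split along their average. -/
theorem IsRun.energy_step_le (hS : IsRun X g f A κ S) (hG : GraphAssumption a Q G A) (hκ : 0 < κ)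
    (hX : ∀ i, Convex ℝ (X i)) (hg : ∀ i k, IsProperConvex fun z => g i z k)
    (hgX : ∀ i k, X i ⊆ interior (effDom fun z => g i z k)) (hf : CostAssumption X Cf f)
    (hgB : ∀ i, ∀ x ∈ X i, ‖realVec (g i) x‖ ≤ B) (hY : 0 ≤ Y)
    (hy : ∀ t i, ‖S.y t i‖ ≤ Y) {z : ∀ i, Eu (n i)} (hz : z ∈ feasibleSet X g) {ν : Eu m}
    (hν : ∀ k, 0 ≤ ν k) (t : ℕ) :
    2 * alpha t * (∑ i, ((f t i (S.x t i)).toReal - (f t i (z i)).toReal)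
        + inner ℝ ν (∑ i, realVec (g i) (S.x t i))) ≤
      energy S z ν t - energy S z ν (t + 1) + 2 * alpha t * ((Y + 2 * B) * dispersion (S.μ t))
        + alpha t ^ 2 * (∑ i, ‖S.s (t + 1) i‖ ^ 2 + N * (2 * Y) ^ 2)
        + alpha t * beta κ t * (N * ‖ν‖ ^ 2) := by
  have hα := alpha_pos t
  have h1 := sum_le_sum fun i (_ : i ∈ univ) =>
    hS.primal_step_le hG hX hg hgX hf t i (hz.1 i)
  have h2 := sum_le_sum fun i (_ : i ∈ univ) => hS.dual_step_le hG hκ hY hy t i hν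
  have h3 := sum_norm_sq_mix_sub_le hG S.μ t ν
  simp only [sum_add_distrib, sum_sub_distrib, ← mul_sum, sum_const, card_univ,
    Fintype.card_fin, nsmul_eq_mul, ← inner_sum, sum_mix hG, hS.sum_y hG] at h1 h2
  -- These vectors sum to `∑ g i (z i) ≤ 0`, so pairing them with the nonnegative average multiplier
  -- is harmless; only the deviation from that average costs.
  set v : Fin N → Eu m := fun i => mix A S.y t i - (realVec (g i) (S.x t i) - realVec (g i) (z i))
    with hv
  have h4 : ∑ i, inner ℝ (mix A S.μ t i) (mix A S.y t i)
      - ∑ i, inner ℝ (mix A S.μ t i) (realVec (g i) (S.x t i) - realVec (g i) (z i))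
      ≤ (Y + 2 * B) * dispersion (S.μ t) := by
    have hsumv : ∑ i, v i = ∑ i, realVec (g i) (z i) := by
      simp only [hv, sum_sub_distrib, sum_mix hG, hS.sum_y hG]
      abel
    have hvb : ∀ i, ‖v i‖ ≤ Y + 2 * B := fun i => by
      have := norm_sub_le (mix A S.y t i) (realVec (g i) (S.x t i) - realVec (g i) (z i))
      have := norm_sub_le (realVec (g i) (S.x t i)) (realVec (g i) (z i))
      linarith [norm_mix_le hG (hy t) i, hgB i _ (hS.x_mem t i), hgB i _ (hz.1 i)]
    have havg : ∀ k, 0 ≤ average (S.μ t) k := fun k => by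
      simp only [average, WithLp.ofLp_sum, WithLp.ofLp_smul, Finset.sum_apply, Pi.smul_apply,
        smul_eq_mul]
      exact mul_nonneg (by positivity) (sum_nonneg fun i _ => hS.μ_nonneg t i k)
    calc _ = ∑ i, inner ℝ (mix A S.μ t i) (v i) := by
          rw [← sum_sub_distrib]
          exact sum_congr rfl fun i _ => (inner_sub_right _ _ _).symm
      _ = ∑ i, inner ℝ (mix A S.μ t i - average (S.μ t)) (v i)
          + inner ℝ (average (S.μ t)) (∑ i, v i) := by
          simp only [inner_sub_left, sum_sub_distrib, inner_sum]
          ring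
      _ ≤ ∑ i, (Y + 2 * B) * ‖mix A S.μ t i - average (S.μ t)‖ + 0 := by
          refine add_le_add (sum_le_sum fun i _ => ?_) ?_
          · refine (real_inner_le_norm _ _).trans ?_
            rw [mul_comm]
            exact mul_le_mul_of_nonneg_right (hvb i) (norm_nonneg _)
          · rw [hsumv]
            exact inner_nonpos_of_nonneg_of_nonpos havg hz.2
      _ ≤ (Y + 2 * B) * dispersion (S.μ t) := by
          rw [add_zero, ← mul_sum]
          rcases Nat.eq_zero_or_pos N with rfl | hN
          · simp [dispersion]
          · have : 0 ≤ Y + 2 * B := (norm_nonneg _).trans (hvb ⟨0, hN⟩)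
            exact mul_le_mul_of_nonneg_left (sum_norm_mix_sub_average_le hG S.μ t) this
  have h5 := mul_le_mul_of_nonneg_left h4 (by positivity : 0 ≤ 2 * alpha t)
  simp only [sum_sub_distrib] at h5 ⊢
  unfold energy
  linarith

theorem sum_Icc_one_eq_sum_range {M : Type*} [AddCommMonoid M] (F : ℕ → M) (T : ℕ) :
    ∑ t ∈ Icc 1 T, F t = ∑ t ∈ range T, F (t + 1) := by
  induction T with
  | zero => simp
  | succ T ih => rw [sum_Icc_succ_top (by omega), ih, sum_range_succ]

/-- The regret inequality, penalized by the constraint values weighted with any `ν ≥ 0`. -/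
theorem IsRun.regret_add_inner_le (hS : IsRun X g f A κ S) (hG : GraphAssumption a Q G A)
    (hκ : 0 < κ) (hκ1 : κ < 1 / 4)
    (hX : ∀ i, Convex ℝ (X i)) (hg : ∀ i k, IsProperConvex fun z => g i z k)
    (hgX : ∀ i k, X i ⊆ interior (effDom fun z => g i z k)) (hf : CostAssumption X Cf f)
    (hB : 0 ≤ B) (hgB : ∀ i, ∀ x ∈ X i, ‖realVec (g i) x‖ ≤ B) (hY : 0 ≤ Y)
    (hy : ∀ t i, ‖S.y t i‖ ≤ Y) {Lg D E : ℝ} (hLg : 0 ≤ Lg)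
    (hgL : ∀ i k, ∀ x ∈ X i, ∀ q ∈ subdiff (fun z => g i z k) x, ‖q‖ ≤ Lg)
    (hD : ∀ i, ∀ x ∈ X i, ∀ z ∈ X i, ‖x - z‖ ≤ D) {T : ℕ} (hT : 1 ≤ T)
    (hE : ∑ t ∈ range T, dispersion (S.μ (t + 1)) ≤ E * Real.sqrt T) (hE0 : 0 ≤ E)
    {z : ∀ i, Eu (n i)} (hz : z ∈ feasibleSet X g) {ν : Eu m} (hν : ∀ k, 0 ≤ ν k) :
    2 * (regret f S.x z T + inner ℝ ν (∑ t ∈ Icc 1 T, ∑ i, realVec (g i) (S.x t i))) ≤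
      (N * D ^ 2 + 2 * (N * Y ^ 2) + 2 * ((Y + 2 * B) * E)
        + 2 * (N * (|Cf| + m * Lg * Y) ^ 2 + N * (2 * Y) ^ 2)) * (T : ℝ) ^ (1 / 2 + 2 * κ)
        + 4 * (N * ‖ν‖ ^ 2) * (T : ℝ) ^ (1 - κ) := by
  set R := Real.sqrt T with hR
  set Θ := (T : ℝ) ^ (2 * κ) with hΘ
  set W := (T : ℝ) ^ (1 - κ) with hW
  set Cs := |Cf| + m * Lg * Y with hCs
  have hT1 : (1 : ℝ) ≤ T := by exact_mod_cast hT
  have hT0 : (0 : ℝ) < T := by linarith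
  have hR0 : 0 ≤ R := Real.sqrt_nonneg _
  have hΘ1 : 1 ≤ Θ := Real.one_le_rpow hT1 (by linarith)
  have hRΘ : (T : ℝ) ^ (1 / 2 + 2 * κ) = R * Θ := by
    rw [hR, Real.sqrt_eq_rpow, ← Real.rpow_add hT0]
  have hRW : R ≤ W := by
    rw [hR, Real.sqrt_eq_rpow]
    exact Real.rpow_le_rpow_of_exponent_le hT1 (by linarith)
  have hCs0 : 0 ≤ Cs := by positivity
  -- Multipliers and subgradients grow like `1 / β t`, so their squares cost `Θ = T ^ (2κ)`, the
  -- source of `2κ` in the regret exponent.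
  have hβT : ∀ t, t ≤ T → (beta κ t)⁻¹ ^ 2 ≤ Θ := fun t ht => by
    rw [hΘ, ← inv_beta_sq (show T ≠ 0 by omega)]
    have := beta_pos κ T
    have := beta_pos κ t
    gcongr
    exact beta_antitone hκ ht
  have hμ : ∀ t, t ≤ T → ∀ i, ‖S.μ t i‖ ^ 2 ≤ Y ^ 2 * Θ := fun t ht i => by
    calc ‖S.μ t i‖ ^ 2 ≤ (Y * (beta κ t)⁻¹) ^ 2 := by
          gcongr
          exact hS.norm_μ_le hG hκ hY hy t i
      _ ≤ Y ^ 2 * Θ := by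
          rw [mul_pow]
          gcongr
          exact hβT t ht
  have hs : ∀ t, t ≤ T → ∑ i, ‖S.s (t + 1) i‖ ^ 2 ≤ N * Cs ^ 2 * Θ := fun t ht => by
    refine (sum_le_card_nsmul _ _ (Cs ^ 2 * Θ) fun i _ => ?_).trans_eq (by simp [mul_assoc])
    have hβ1 : 1 ≤ (beta κ t)⁻¹ := (one_le_inv₀ (beta_pos κ t)).2 (beta_le_one hκ t)
    have h1 := norm_le_of_mem_lagrangianSubdiff hLg (hf.subgrad_le t i _ (hS.x_mem t i))
      (fun k => hgL i k _ (hS.x_mem t i)) (hS.s_succ_mem hG t i)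
    have h2 := norm_mix_le hG (hS.norm_μ_le hG hκ hY hy t) i
    have h3 : ‖S.s (t + 1) i‖ ≤ Cs * (beta κ t)⁻¹ := by
      calc _ ≤ |Cf| * (beta κ t)⁻¹ + m * Lg * (Y * (beta κ t)⁻¹) := by
            refine h1.trans (add_le_add ?_ (by gcongr))
            exact (le_abs_self Cf).trans (le_mul_of_one_le_right (abs_nonneg _) hβ1)
        _ = _ := by ring
    calc ‖S.s (t + 1) i‖ ^ 2 ≤ (Cs * (beta κ t)⁻¹) ^ 2 := by gcongr
      _ ≤ Cs ^ 2 * Θ := by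
        rw [mul_pow]
        gcongr
        exact hβT t ht
  have henergy : ∀ t, 1 ≤ t → t ≤ T →
      energy S z ν t ≤ N * D ^ 2 + 2 * (N * Y ^ 2) * Θ + 2 * (N * ‖ν‖ ^ 2) := fun t _ ht => by
    have h1 : ∑ i, ‖S.x t i - z i‖ ^ 2 ≤ N * D ^ 2 := by
      refine (sum_le_card_nsmul _ _ (D ^ 2) fun i _ => ?_).trans_eq (by simp)
      gcongr
      exact hD i _ (hS.x_mem t i) _ (hz.1 i)
    have h2 : ∑ i, ‖S.μ t i - ν‖ ^ 2 ≤ N * (2 * (Y ^ 2 * Θ) + 2 * ‖ν‖ ^ 2) := by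
      refine (sum_le_card_nsmul _ _ (2 * (Y ^ 2 * Θ) + 2 * ‖ν‖ ^ 2) fun i _ => ?_).trans_eq
        (by simp [mul_add])
      have h3 := parallelogram_law_with_norm ℝ (S.μ t i) ν
      nlinarith [hμ t ht i, mul_self_nonneg ‖S.μ t i + ν‖]
    unfold energy
    linarith
  -- The energy inequality divided by `α (t + 1)`, whose inverse is `√(t + 1)`.
  have hstep : ∀ t ∈ range T, 2 * (∑ i, ((f (t + 1) i (S.x (t + 1) i)).toReal
        - (f (t + 1) i (z i)).toReal) + inner ℝ ν (∑ i, realVec (g i) (S.x (t + 1) i))) ≤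
      Real.sqrt (t + 1 : ℕ) * (energy S z ν (t + 1) - energy S z ν (t + 2))
        + 2 * (Y + 2 * B) * dispersion (S.μ (t + 1))
        + (N * Cs ^ 2 * Θ + N * (2 * Y) ^ 2) * alpha (t + 1)
        + N * ‖ν‖ ^ 2 * beta κ (t + 1) := fun t ht => by
    have hα := alpha_pos (t + 1)
    have h1 := hS.energy_step_le hG hκ hX hg hgX hf hgB hY hy hz hν (t + 1)
    have h2 := hs (t + 1) (mem_range.1 ht)
    have h3 := mul_le_mul_of_nonneg_left h1 (inv_pos.2 hα).le
    have h4 : alpha (t + 1) * ∑ i, ‖S.s (t + 1 + 1) i‖ ^ 2 ≤ alpha (t + 1) * (N * Cs ^ 2 * Θ) := by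
      gcongr
    rw [← inv_alpha (Nat.succ_ne_zero t)]
    have h5 : (alpha (t + 1))⁻¹ * alpha (t + 1) = 1 := inv_mul_cancel₀ hα.ne'
    set b := (alpha (t + 1))⁻¹
    set F := ∑ i, ((f (t + 1) i (S.x (t + 1) i)).toReal
        - (f (t + 1) i (z i)).toReal) + inner ℝ ν (∑ i, realVec (g i) (S.x (t + 1) i))
    have h6 : b * (2 * alpha (t + 1) * F) = 2 * F := by
      linear_combination 2 * F * h5
    rw [h6] at h3
    refine h3.trans (le_of_sub_nonneg ?_)
    have h7 : b * (energy S z ν (t + 1) - energy S z ν (t + 1 + 1)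
          + 2 * alpha (t + 1) * ((Y + 2 * B) * dispersion (S.μ (t + 1)))
          + alpha (t + 1) ^ 2 * (∑ i, ‖S.s (t + 1 + 1) i‖ ^ 2 + N * (2 * Y) ^ 2)
          + alpha (t + 1) * beta κ (t + 1) * (N * ‖ν‖ ^ 2))
        = b * (energy S z ν (t + 1) - energy S z ν (t + 2))
          + 2 * (Y + 2 * B) * dispersion (S.μ (t + 1))
          + alpha (t + 1) * (∑ i, ‖S.s (t + 1 + 1) i‖ ^ 2 + N * (2 * Y) ^ 2)
          + N * ‖ν‖ ^ 2 * beta κ (t + 1) := by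
      linear_combination (2 * ((Y + 2 * B) * dispersion (S.μ (t + 1)))
        + alpha (t + 1) * (∑ i, ‖S.s (t + 1 + 1) i‖ ^ 2 + N * (2 * Y) ^ 2)
        + beta κ (t + 1) * (N * ‖ν‖ ^ 2)) * h5
    rw [h7]
    linarith
  have habel : ∑ t ∈ range T, Real.sqrt (t + 1 : ℕ) *
      (energy S z ν (t + 1) - energy S z ν (t + 2)) ≤
      R * (N * D ^ 2 + 2 * (N * Y ^ 2) * Θ + 2 * (N * ‖ν‖ ^ 2)) :=
    sum_mul_sub_succ_le (c := fun t : ℕ => Real.sqrt t)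
      (fun s t hst => Real.sqrt_le_sqrt (by exact_mod_cast hst)) (fun _ => Real.sqrt_nonneg _)
      (energy_nonneg S z ν) henergy (by positivity)
  have hsum := sum_le_sum hstep
  simp only [sum_add_distrib, ← mul_sum, ← inner_sum] at hsum
  have hlhs : 2 * (regret f S.x z T + inner ℝ ν (∑ t ∈ Icc 1 T, ∑ i, realVec (g i) (S.x t i))) =
      2 * (∑ t ∈ range T, ∑ i, ((f (t + 1) i (S.x (t + 1) i)).toReal
        - (f (t + 1) i (z i)).toReal)
        + inner ℝ ν (∑ t ∈ range T, ∑ i, realVec (g i) (S.x (t + 1) i))) := by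
    simp only [regret, totalCost, sum_Icc_one_eq_sum_range, sum_sub_distrib]
  rw [hlhs, hRΘ]
  -- The energy bound contributes `2 N ‖ν‖² √T` and the penalties another `2 N ‖ν‖² T ^ (1 - κ)`;
  -- `√T ≤ T ^ (1 - κ)` merges them into the coefficient 4.
  have h1 := mul_le_mul_of_nonneg_left hE (by positivity : 0 ≤ 2 * (Y + 2 * B))
  have h2 := mul_le_mul_of_nonneg_left (sum_alpha_le T)
    (by positivity : 0 ≤ N * Cs ^ 2 * Θ + N * (2 * Y) ^ 2)
  have h3 := mul_le_mul_of_nonneg_left (sum_beta_le hκ1 hT) (by positivity : 0 ≤ N * ‖ν‖ ^ 2)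
  have h4 : R ≤ R * Θ := le_mul_of_one_le_right hR0 hΘ1
  have h5 := mul_le_mul_of_nonneg_left h4 (by positivity : 0 ≤ N * D ^ 2
    + 2 * ((Y + 2 * B) * E) + 2 * (N * (2 * Y) ^ 2))
  have h6 := mul_le_mul_of_nonneg_left hRW (by positivity : 0 ≤ 2 * (N * ‖ν‖ ^ 2))
  linarith

/-- Bounded subgradients make the costs Lipschitz on the local sets. -/
theorem CostAssumption.toReal_sub_le (hf : CostAssumption X Cf f) {D : ℝ}
    (hD : ∀ i, ∀ x ∈ X i, ∀ z ∈ X i, ‖x - z‖ ≤ D) (t : ℕ) {i : Fin N} {x z : Eu (n i)}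
    (hx : x ∈ X i) (hz : z ∈ X i) : (f t i z).toReal - (f t i x).toReal ≤ |Cf| * D := by
  obtain ⟨s, hs⟩ := (hf.convex t i).subdiff_nonempty (hf.finite_near t i hz)
  have h1 := (hf.convex t i).subgradient_ineq (interior_subset (hf.finite_near t i hz))
    (interior_subset (hf.finite_near t i hx)) hs
  have h2 : -inner ℝ s (x - z) ≤ |Cf| * D := by
    refine (neg_le_abs _).trans ((abs_real_inner_le_norm _ _).trans ?_)
    exact mul_le_mul ((hf.subgrad_le t i z hz s hs).trans (le_abs_self _)) (hD i x hx z hz)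
      (norm_nonneg _) (abs_nonneg _)
  linarith

theorem isCompact_feasibleSet (hX : ∀ i, IsCompact (X i))
    (hg : ∀ i k, IsProperConvex fun z => g i z k)
    (hgX : ∀ i k, X i ⊆ interior (effDom fun z => g i z k)) : IsCompact (feasibleSet X g) := by
  have hpi : IsCompact (Set.univ.pi X) := isCompact_univ_pi hX
  -- The product set is repeated inside each constraint because the constraint sums are known to be
  -- continuous only on it.
  have heq : feasibleSet X g = Set.univ.pi X ∩
      ⋂ k, Set.univ.pi X ∩ (fun x => ∑ i, (g i (x i) k).toReal) ⁻¹' Set.Iic 0 := by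
    ext x
    simp only [feasibleSet, Set.mem_ofPred_eq, Set.mem_inter_iff, Set.mem_iInter, Set.mem_univ_pi,
      Set.mem_preimage, Set.mem_Iic, WithLp.ofLp_sum, Finset.sum_apply, realVec]
    exact ⟨fun h => ⟨h.1, fun k => ⟨h.1, h.2 k⟩⟩, fun h => ⟨h.1, fun k => (h.2 k).2⟩⟩
  rw [heq]
  refine hpi.inter_right (isClosed_iInter fun k => ?_)
  refine ContinuousOn.preimage_isClosed_of_isClosed ?_ hpi.isClosed isClosed_Iic
  refine continuousOn_finsetSum _ fun i _ => ?_
  exact ((hg i k).continuousOn_toReal.mono (hgX i k)).comp (continuous_apply i).continuousOn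
    fun x hx => hx i (Set.mem_univ i)

theorem CostAssumption.exists_isBestFixed (hf : CostAssumption X Cf f)
    (hX : ∀ i, IsCompact (X i)) (hg : ∀ i k, IsProperConvex fun z => g i z k)
    (hgX : ∀ i k, X i ⊆ interior (effDom fun z => g i z k)) (hfeas : (feasibleSet X g).Nonempty)
    (T : ℕ) : ∃ z, IsBestFixed X g f T z := by
  obtain ⟨z, hz, hmin⟩ := (isCompact_feasibleSet hX hg hgX).exists_isMinOn hfeas
    (f := fun z => totalCost f (fun _ => z) T) (by
      refine continuousOn_finsetSum _ fun t _ => continuousOn_finsetSum _ fun i _ => ?_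
      exact ((hf.convex t i).continuousOn_toReal.mono (hf.finite_near t i)).comp
        (continuous_apply i).continuousOn fun x hx => hx.1 i)
  exact ⟨z, hz, fun z' hz' => hmin hz'⟩

/-- A bound on `⟨ν, v⟩` for all `ν ≥ 0`, with quadratic growth in `ν`, bounds the positive part
of `v`. -/
theorem norm_orthantProj_sq_le {v : Eu m} {P q : ℝ} (hq : 0 < q)
    (h : ∀ ν : Eu m, (∀ k, 0 ≤ ν k) → 2 * inner ℝ ν v ≤ P + q * ‖ν‖ ^ 2) :
    ‖orthantProj v‖ ^ 2 ≤ P * q := by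
  -- This `ν` maximizes `2 ⟨ν, v⟩ - q ‖ν‖²` over the orthant.
  have h1 := h (q⁻¹ • orthantProj v) fun k =>
    mul_nonneg (inv_pos.2 hq).le (orthantProj_nonneg v k)
  rw [real_inner_smul_left, inner_orthantProj_self, norm_smul, norm_inv,
    Real.norm_of_nonneg hq.le] at h1
  have h2 : q * (q⁻¹ * ‖orthantProj v‖) ^ 2 = q⁻¹ * ‖orthantProj v‖ ^ 2 := by field_simp
  rw [h2] at h1
  have h3 : q⁻¹ * ‖orthantProj v‖ ^ 2 ≤ P := by linarith
  rwa [inv_mul_le_iff₀ hq, mul_comm q] at h3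

theorem exists_uniform_bound {ι : Type*} [Finite ι] {p : ι → ℝ → Prop}
    (hp : ∀ i b c, b ≤ c → p i b → p i c) (h : ∀ i, ∃ b, p i b) : ∃ b, 0 ≤ b ∧ ∀ i, p i b := by
  choose b hb using h
  obtain ⟨c, hc⟩ := (Set.finite_range b).bddAbove
  exact ⟨max c 0, le_max_right _ _, fun i =>
    hp i _ _ ((hc ⟨i, rfl⟩).trans (le_max_left _ _)) (hb i)⟩

theorem exists_realVec_bound (hX : ∀ i, IsCompact (X i))
    (hg : ∀ i k, IsProperConvex fun z => g i z k)
    (hgX : ∀ i k, X i ⊆ interior (effDom fun z => g i z k)) :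
    ∃ B : ℝ, 0 ≤ B ∧ ∀ i, ∀ x ∈ X i, ‖realVec (g i) x‖ ≤ B := by
  refine exists_uniform_bound (fun _ _ _ hbc h x hx => (h x hx).trans hbc) fun i => ?_
  refine (hX i).exists_bound_of_continuousOn ?_
  refine (PiLp.continuous_toLp 2 _).comp_continuousOn (continuousOn_pi.2 fun k => ?_)
  exact (hg i k).continuousOn_toReal.mono (hgX i k)

theorem exists_norm_sub_bound (hX : ∀ i, IsCompact (X i)) :
    ∃ D : ℝ, 0 ≤ D ∧ ∀ i, ∀ x ∈ X i, ∀ z ∈ X i, ‖x - z‖ ≤ D :=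
  exists_uniform_bound (fun _ _ _ hbc h x hx z hz => (h x hx z hz).trans hbc) fun i =>
    ⟨Metric.diam (X i), fun x hx z hz =>
      dist_eq_norm x z ▸ Metric.dist_le_diam_of_mem (hX i).isBounded hx hz⟩

theorem exists_constraint_subgradient_bound (hX : ∀ i, IsCompact (X i))
    (hg : ∀ i k, IsProperConvex fun z => g i z k)
    (hgX : ∀ i k, X i ⊆ interior (effDom fun z => g i z k)) :
    ∃ L : ℝ, 0 ≤ L ∧ ∀ i k, ∀ x ∈ X i, ∀ q ∈ subdiff (fun z => g i z k) x, ‖q‖ ≤ L := by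
  obtain ⟨L, hL, h⟩ := exists_uniform_bound (ι := Fin N × Fin m)
    (p := fun j b => ∀ x ∈ X j.1, ∀ q ∈ subdiff (fun z => g j.1 z j.2) x, ‖q‖ ≤ b)
    (fun _ _ _ hbc h x hx q hq => (h x hx q hq).trans hbc) fun j => by
      obtain ⟨L, -, h⟩ := (hg j.1 j.2).exists_subgradient_bound (hX j.1) (hgX j.1 j.2)
      exact ⟨L, h⟩
  exact ⟨L, hL, fun i k => h (i, k)⟩

end RegretAnalysis

end OnlinePushSum

/-! ### Choice of constants and the two bounds -/

open OnlinePushSum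
theorem theorem1 {N m : ℕ} {n : Fin N → ℕ}
    -- the compact convex local sets and the constraint functions
    (X : ∀ i, Set (Eu (n i))) (g : ∀ i, Eu (n i) → Fin m → EReal)
    (hXconv : ∀ i, Convex ℝ (X i)) (hXcomp : ∀ i, IsCompact (X i))
    (hg : ∀ i k, IsProperConvex (fun z => g i z k))
    (hgX : ∀ i k, X i ⊆ interior (effDom (fun z => g i z k)))
    (hfeas : (feasibleSet X g).Nonempty)
    -- the parameters of the graphs, of the costs and of the stepsizes
    (a : ℝ) (ha0 : 0 < a) (ha1 : a < 1) (Q : ℕ) (hQ : 0 < Q) (Cf : ℝ)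
    (κ : ℝ) (hκ0 : 0 < κ) (hκ1 : κ < 1 / 4) :
    ∃ C : ℝ, 0 < C ∧
      ∀ f : ℕ → ∀ i, Eu (n i) → EReal, CostAssumption X Cf f →
      ∀ (G : ℕ → Digraph (Fin N)) (A : ℕ → Matrix (Fin N) (Fin N) ℝ),
        GraphAssumption a Q G A →
      ∀ S : Iterates N m n, IsRun X g f A κ S →
      ∀ T : ℕ, 1 ≤ T →
        (∃ z, IsBestFixed X g f T z) ∧
        (∀ z, IsBestFixed X g f T z → regret f S.x z T ≤ C * (T : ℝ) ^ (1 / 2 + 2 * κ)) ∧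
        violation g S.x T ≤ C * (T : ℝ) ^ (1 - κ / 2) := by
  obtain ⟨B, hB, hgB⟩ := exists_realVec_bound hXcomp hg hgX
  obtain ⟨D, hD0, hD⟩ := exists_norm_sub_bound hXcomp
  obtain ⟨Lg, hLg, hgL⟩ := exists_constraint_subgradient_bound hXcomp hg hgX
  obtain ⟨Y, hY, hyb⟩ := exists_tracker_bound X g hB hgB ha0 ha1 hQ κ
  obtain ⟨E, hE0, hE⟩ := exists_sum_dispersion_μ_le N Q ha0 hY
  set K : ℝ := N * D ^ 2 + 2 * (N * Y ^ 2) + 2 * ((Y + 2 * B) * E)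
    + 2 * (N * (|Cf| + m * Lg * Y) ^ 2 + N * (2 * Y) ^ 2) with hK
  have hK0 : 0 ≤ K := by positivity
  -- The extra term absorbs the crude lower bound `-T * N * |Cf| * D` on the regret.
  set P : ℝ := K + 2 * (N * (|Cf| * D)) with hP
  have hP0 : 0 ≤ P := by positivity
  -- The added 1 keeps `q` positive when there are no agents.
  set q : ℝ := 4 * N + 1 with hq
  have hq0 : 0 < q := by positivity
  -- The regret needs `K`; the violation needs a square at least `P * q`, which holds because the
  -- constant is at least 1 and at least `P * q`.
  refine ⟨K + P * q + 1, by positivity, fun f hf G A hG S hS T hT => ?_⟩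
  have hT1 : (1 : ℝ) ≤ T := by exact_mod_cast hT
  have hT0 : (0 : ℝ) < T := by linarith
  have hbound : ∀ z ∈ feasibleSet X g, ∀ ν : Eu m, (∀ k, 0 ≤ ν k) →
      2 * (regret f S.x z T + inner ℝ ν (∑ t ∈ Icc 1 T, ∑ i, realVec (g i) (S.x t i))) ≤
        K * (T : ℝ) ^ (1 / 2 + 2 * κ) + 4 * (N * ‖ν‖ ^ 2) * (T : ℝ) ^ (1 - κ) :=
    fun z hz ν hν => hS.regret_add_inner_le hG hκ0 hκ1 hXconv hg hgX hf hB hgB hY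
      (hyb f G A hG S hS) hLg hgL hD hT (hE hκ0 hG hS (hyb f G A hG S hS) T hT) hE0 hz hν
  refine ⟨hf.exists_isBestFixed hXcomp hg hgX hfeas T, fun z hz => ?_, ?_⟩
  · have h := hbound z hz.1 0 (fun _ => le_rfl)
    simp only [inner_zero_left, add_zero, norm_zero, ne_eq, OfNat.ofNat_ne_zero,
      not_false_eq_true, zero_pow, mul_zero, zero_mul] at h
    have hpow : 0 ≤ (T : ℝ) ^ (1 / 2 + 2 * κ) := by positivity
    have h1 := mul_nonneg hK0 hpow
    have h2 := mul_nonneg (mul_nonneg hP0 hq0.le) hpow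
    linarith
  · obtain ⟨z, hz⟩ := hfeas
    have hreg : -(T * (N * (|Cf| * D))) ≤ regret f S.x z T := by
      have h : ∑ t ∈ Icc 1 T, ∑ i, ((f t i (z i)).toReal - (f t i (S.x t i)).toReal) ≤
          T * (N * (|Cf| * D)) := by
        refine (sum_le_card_nsmul _ _ (N * (|Cf| * D)) fun t _ => ?_).trans_eq (by simp)
        refine (sum_le_card_nsmul _ _ (|Cf| * D) fun i _ => ?_).trans_eq (by simp)
        exact hf.toReal_sub_le hD t (hS.x_mem t i) (hz.1 i)
      simp only [sum_sub_distrib] at h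
      unfold regret totalCost
      linarith
    -- The condition `κ ≤ 1/4` makes the regret-order term no larger than the linear lower bound on
    -- the regret.
    have hTpow : (T : ℝ) ^ (1 / 2 + 2 * κ) ≤ T := by
      simpa using Real.rpow_le_rpow_of_exponent_le hT1 (show 1 / 2 + 2 * κ ≤ 1 by linarith)
    have hTκ : 0 < (T : ℝ) ^ (1 - κ) := by positivity
    have hsq : violation g S.x T ^ 2 ≤ P * T * (q * (T : ℝ) ^ (1 - κ)) := by
      refine norm_orthantProj_sq_le (by positivity) fun ν hν => ?_
      have h := hbound z hz ν hν
      have h1 := mul_le_mul_of_nonneg_left hTpow hK0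
      have h2 : 0 ≤ (T : ℝ) ^ (1 - κ) * ‖ν‖ ^ 2 := by positivity
      rw [hP, hq]
      linarith
    have hTT : (T : ℝ) * (T : ℝ) ^ (1 - κ) = ((T : ℝ) ^ (1 - κ / 2)) ^ 2 := by
      rw [← Real.rpow_natCast, ← Real.rpow_mul hT0.le]
      nth_rewrite 1 [← Real.rpow_one (T : ℝ)]
      rw [← Real.rpow_add hT0]
      congr 1
      push_cast
      ring
    refine le_of_sq_le_sq ?_ (by positivity)
    refine hsq.trans ?_
    have hc : P * q ≤ (K + P * q + 1) ^ 2 := by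
      have h0 : 0 ≤ P * q := by positivity
      have h1 : 1 ≤ K + P * q + 1 := by linarith
      exact (by linarith : P * q ≤ K + P * q + 1).trans (le_self_pow₀ h1 two_ne_zero)
    calc P * T * (q * (T : ℝ) ^ (1 - κ)) = P * q * ((T : ℝ) ^ (1 - κ / 2)) ^ 2 := by
          rw [← hTT]; ring
      _ ≤ (K + P * q + 1) ^ 2 * ((T : ℝ) ^ (1 - κ / 2)) ^ 2 := by gcongr
      _ = _ := by ring
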